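/- A \emph{plane graph} is given combinatorially as a triple $(E,\sigma,\theta)$, where $E$ is a set (of directed edges), $\sigma$ is a permutation of $E$ (next directed edge with the same source in clockwise direction) and $\theta$ is a fixed-point-free involution of $E$ (inverse directed edge); its vertices are the orbits of $\sigma$. An isomorphism of plane graphs is a bijection of the directed edges that commutes with $\sigma$ and $\theta$. The \emph{chamber system} $C_G$ of $G$ is its barycentric subdivision, whose vertices have type $0$, $1$ or $2$ (vertices, edge centres and face centres of $G$), and in which the type $t(e)$ of an edge $e$ is the type of the opposite vertex in an adjacent triangle. Let $T$ be a connected tiling of the Euclidean plane with chamber system $C_T$, and let $v_0,v_2$ be points of the plane such that the clockwise rotations $\rho_{v_0}$ by $120^\circ$ around $v_0$ and $\rho_{v_2}$ by $60^\circ$ around $v_2$ are symmetries of $T$ (so $(T,v_0,v_2)$ is a lopsp operation). Let $v_1$ be the centre of the rotation $\rho_{v_2}\circ\rho_{v_0}$ by $180^\circ$. The \emph{double chamber decoration} $D=(E,\sigma,\theta)$ of $(T,v_0,v_2)$ is the quotient of $C_T$ by the group $\langle\rho_{v_0},\rho_{v_2}\rangle$, with the induced permutations $\sigma,\theta$, the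 induced types $t\colon E\to\{0,1,2\}$ and, as special vertices, the classes of $v_0,v_1,v_2$. Let $P$ be a simple path in $D$ from $v_1$ through $v_0$ to $v_2$. Let $P_1$ be the set of directed edges on the part from $v_1$ to $v_0$, let $P_2$ be the set of directed edges on the part of $P$ between $v_2$ and $v_0$, directed from $v_2$ to $v_0$, and let $P_1'$, $P_2'$ be the sets of their inverses. Let $G$ be a plane graph $(E_G,\sigma_G,\theta_G)$, and let $C=\{c_e : e\in E_G\}$ be its double chambers, with the permutations $s_1(c_e)=c_{\theta_G(e)}$ and $s_2(c_e)=c_{\sigma_G^{-1}\theta_G(e)}$. The \emph{application} of $(D,P)$ to $G$ is the plane graph $D_P(G)=(E\times C,\sigma_P,\theta_P)$ with $$\sigma_P(e,c)=(\sigma(e),s_{P,e}(c)),\qquad \theta_P(e,c)=(\theta(e),s_{P,e}(c)),$$ where $s_{P,e}$ is $s_2$ if $e\in P_2$, $s_1^{-1}$ if $e\in P_1$, $s_2^{-1}$ if $e\in P_2'$, $s_1$ if $e\in P_1'$, and the identity otherwise. \textbf{Theorem.} Let $G$ be a plane graph and let $D$ be the double chamber decoration of a lopsp operation. For any two simple paths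 $P$ and $Q$ in $D$ from $v_1$ through $v_0$ to $v_2$, the plane graphs $D_P(G)$ and $D_Q(G)$ are isomorphic, by an isomorphism that preserves the types of the directed edges, the type of $(e,c)$ being $t(e)$. So the result of applying a lopsp operation to $G$ does not depend on the chosen path. -/

import Mathlib

universe u v

/-! ## Plane graphs as rotation systems -/

/-- A plane graph, given combinatorially as a triple `(E, σ, θ)`: a set `E` of directed edges
(darts), a permutation `σ` of `E` (next dart with the same source, in clockwise direction) and a
fixed-point-free involution `θ` of `E` (the inverse dart). -/
structure PlaneGraph where
  Dart : Type u
  σ : Equiv.Perm Dart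
  θ : Equiv.Perm Dart
  θ_invol : ∀ e, θ (θ e) = e
  θ_ne : ∀ e, θ e ≠ e

namespace PlaneGraph

/-- Isomorphisms of plane graphs: bijections of the darts that commute with `σ` and `θ`. -/
structure Iso (M : PlaneGraph.{u}) (N : PlaneGraph.{v}) extends M.Dart ≃ N.Dart where
  map_σ : ∀ e, toFun (M.σ e) = N.σ (toFun e)
  map_θ : ∀ e, toFun (M.θ e) = N.θ (toFun e)

/-- The vertices of a plane graph are the orbits of `σ`. -/
def Vertex (M : PlaneGraph.{u}) : Type u := Quotient (Equiv.Perm.SameCycle.setoid M.σ)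

/-- The source vertex of a dart. -/
def src (M : PlaneGraph.{u}) (e : M.Dart) : M.Vertex :=
  Quotient.mk (Equiv.Perm.SameCycle.setoid M.σ) e

/-- The target vertex of a dart. -/
def tgt (M : PlaneGraph.{u}) (e : M.Dart) : M.Vertex := M.src (M.θ e)

/-- A plane graph is connected if any two darts are related by the group `⟨σ, θ⟩`. -/
def Connected (M : PlaneGraph.{u}) : Prop :=
  ∀ e f : M.Dart, ∃ g ∈ Subgroup.closure ({M.σ, M.θ} : Set (Equiv.Perm M.Dart)), g e = f

/-! ## The chamber system -/

/-- The darts of the barycentric subdivision of `M`. Its vertices are the vertices of `M`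
(type 0), the edge centres (type 1) and the face centres (type 2). For a dart `e` of `M`
* `ve e` goes from the source of `e` to the centre of `e`, and `ev e` is its inverse;
* `vf e` goes from the source of `e` to the centre of the face on the left of `e` (through the
  corner immediately to the left of `e`), and `fv e` is its inverse;
* `ef e` goes from the centre of `e` to the centre of the face on the left of `e`, and `fe e` is
  its inverse. -/
inductive ChamberDart (E : Type u) : Type u
  | ve (e : E) : ChamberDart E
  | ev (e : E) : ChamberDart E
  | vf (e : E) : ChamberDart E
  | fv (e : E) : ChamberDart E
  | ef (e : E) : ChamberDart E
  | fe (e : E) : ChamberDart E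

namespace ChamberDart

/-- The map on darts of the subdivision induced by a map of darts. -/
def map {E : Type u} {F : Type v} (f : E → F) : ChamberDart E → ChamberDart F
  | ve e => ve (f e)
  | ev e => ev (f e)
  | vf e => vf (f e)
  | fv e => fv (f e)
  | ef e => ef (f e)
  | fe e => fe (f e)

/-- The dart of the original graph to which a dart of the subdivision is attached. -/
def base {E : Type u} : ChamberDart E → E
  | ve e | ev e | vf e | fv e | ef e | fe e => e

/-- The type of the source vertex. -/
def srcType {E : Type u} : ChamberDart E → Fin 3
  | ve _ | vf _ => 0
  | ev _ | ef _ => 1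
  | fv _ | fe _ => 2

/-- The type of an edge of the subdivision: the type of the opposite vertex in the adjacent
triangles. -/
def edgeType {E : Type u} : ChamberDart E → Fin 3
  | ef _ | fe _ => 0
  | vf _ | fv _ => 1
  | ve _ | ev _ => 2

theorem srcType_map {E : Type u} {F : Type v} (f : E → F) (d : ChamberDart E) :
    (d.map f).srcType = d.srcType := by
  cases d <;> rfl

theorem edgeType_map {E : Type u} {F : Type v} (f : E → F) (d : ChamberDart E) :
    (d.map f).edgeType = d.edgeType := by
  cases d <;> rfl

/-- The permutation of the darts of the subdivision induced by a permutation of the darts. -/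
def mapPerm {E : Type u} (f : Equiv.Perm E) : Equiv.Perm (ChamberDart E) where
  toFun := map f
  invFun := map f.symm
  left_inv d := by cases d <;> simp [map]
  right_inv d := by cases d <;> simp [map]

end ChamberDart

open ChamberDart in
/-- The chamber system `C_M` of `M`, i.e. its barycentric subdivision as a plane graph. Recall that
the darts with a given face on the left form an orbit of `σθ`, traversed counterclockwise. -/
def chamberSystem (M : PlaneGraph.{u}) : PlaneGraph.{u} where
  Dart := ChamberDart M.Dart
  σ :=
    { toFun := fun
        | vf e => ve e
        | ve e => vf (M.σ e)
        | ev e => ef e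
        | ef e => ev (M.θ e)
        | fe e => fv e
        | fv e => fe ((M.σ * M.θ)⁻¹ e)
      invFun := fun
        | ve e => vf e
        | vf e => ve (M.σ⁻¹ e)
        | ef e => ev e
        | ev e => ef (M.θ e)
        | fv e => fe e
        | fe e => fv ((M.σ * M.θ) e)
      left_inv := fun d => by cases d <;> simp [M.θ_invol]
      right_inv := fun d => by cases d <;> simp [M.θ_invol] }
  θ :=
    { toFun := fun
        | ve e => ev e
        | ev e => ve e
        | vf e => fv e
        | fv e => vf e
        | ef e => fe e
        | fe e => ef e
      invFun := fun
        | ve e => ev e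
        | ev e => ve e
        | vf e => fv e
        | fv e => vf e
        | ef e => fe e
        | fe e => ef e
      left_inv := fun d => by cases d <;> rfl
      right_inv := fun d => by cases d <;> rfl }
  θ_invol := fun d => by cases d <;> rfl
  θ_ne := fun d => by cases d <;> simp

/-- All faces of a chamber system are triangles. -/
theorem chamberSystem_triangle (M : PlaneGraph.{u}) (d : M.chamberSystem.Dart) :
    ((M.chamberSystem.σ * M.chamberSystem.θ) ^ 3) d = d := by
  cases d with
  | ve e => rfl
  | ef e => rfl
  | fv e => rfl
  | ev e =>
    change ChamberDart.ev (M.θ ((M.σ * M.θ)⁻¹ (M.σ e))) = ChamberDart.ev e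
    simp
  | vf e =>
    change ChamberDart.vf (M.σ (M.θ ((M.σ * M.θ)⁻¹ e))) = ChamberDart.vf e
    simp
  | fe e =>
    change ChamberDart.fe ((M.σ * M.θ)⁻¹ (M.σ (M.θ e))) = ChamberDart.fe e
    simp

/-- The chambers (faces of the chamber system) of `M`: `(e, true)` is the triangle on the left of
`ve e`, `(e, false)` the triangle on the right of `ve e`. -/
abbrev Chamber (M : PlaneGraph.{u}) : Type u := M.Dart × Bool

/-- The chamber that shares with the given chamber its side of type `i` (the side opposite to its
corner of type `i`). -/
def adjChamber (M : PlaneGraph.{u}) : Fin 3 → M.Chamber → M.Chamber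
  | 0, (e, b) => (M.θ e, !b)
  | 1, (e, true) => (M.σ⁻¹ e, false)
  | 1, (e, false) => (M.σ e, true)
  | 2, (e, b) => (e, !b)

/-- Two chambers of `M`, seen as triangles with barycentric coordinates indexed by the types of
their corners, share the point with coordinates `x` if one passes from one to the other across
sides that contain this point. -/
def SharePoint (M : PlaneGraph.{u}) (x : stdSimplex ℝ (Fin 3)) : M.Chamber → M.Chamber → Prop :=
  Relation.EqvGen fun c c' => ∃ i, x.1 i = 0 ∧ c' = M.adjChamber i c

/-! ## Quotients -/

/-- The quotient `(E/H, σ, θ)` of a plane graph by a group `H` of permutations of the darts that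
commute with `σ` and `θ`, where no dart is equivalent to its inverse. -/
def quotient (M : PlaneGraph.{u}) (H : Subgroup (Equiv.Perm M.Dart))
    (hσ : ∀ g ∈ H, ∀ d, g (M.σ d) = M.σ (g d)) (hθ : ∀ g ∈ H, ∀ d, g (M.θ d) = M.θ (g d))
    (hne : ∀ g ∈ H, ∀ d, g d ≠ M.θ d) : PlaneGraph.{u} where
  Dart := MulAction.orbitRel.Quotient H M.Dart
  σ := Quotient.congr M.σ (by
    intro a b
    constructor
    · rintro ⟨g, hg⟩
      exact ⟨g, by
        change g.1 b = a at hg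
        change g.1 (M.σ b) = M.σ a
        rw [hσ _ g.2, hg]⟩
    · rintro ⟨g, hg⟩
      exact ⟨g, by
        change g.1 (M.σ b) = M.σ a at hg
        change g.1 b = a
        rw [hσ _ g.2] at hg
        exact M.σ.injective hg⟩)
  θ := Quotient.congr M.θ (by
    intro a b
    constructor
    · rintro ⟨g, hg⟩
      exact ⟨g, by
        change g.1 b = a at hg
        change g.1 (M.θ b) = M.θ a
        rw [hθ _ g.2, hg]⟩
    · rintro ⟨g, hg⟩
      exact ⟨g, by
        change g.1 (M.θ b) = M.θ a at hg
        change g.1 b = a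
        rw [hθ _ g.2] at hg
        exact M.θ.injective hg⟩)
  θ_invol := by
    rintro ⟨d⟩
    exact congrArg _ (M.θ_invol d)
  θ_ne := by
    rintro ⟨d⟩ h
    obtain ⟨g, hg⟩ := Quotient.exact h
    exact hne g.1 g.2 d hg

/-! ## Simple paths -/

/-- `M.IsWalk a l b`: the list `l` of darts is a walk from the vertex `a` to the vertex `b`. -/
def IsWalk (M : PlaneGraph.{u}) : M.Vertex → List M.Dart → M.Vertex → Prop
  | a, [], b => a = b
  | a, d :: l, b => M.src d = a ∧ M.IsWalk (M.tgt d) l b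

/-- A simple path from `v₁` through `v₀` to `v₂`: a walk `l₁` from `v₁` to `v₀` followed by a walk
`l₂` from `v₀` to `v₂`, such that all visited vertices are different. -/
structure CutPath (M : PlaneGraph.{u}) (v₀ v₁ v₂ : M.Vertex) where
  l₁ : List M.Dart
  l₂ : List M.Dart
  walk₁ : M.IsWalk v₁ l₁ v₀
  walk₂ : M.IsWalk v₀ l₂ v₂
  simple : (v₁ :: (l₁ ++ l₂).map M.tgt).Nodup

theorem IsWalk.append {M : PlaneGraph.{u}} {a b c : M.Vertex} {l l' : List M.Dart}
    (h : M.IsWalk a l b) (h' : M.IsWalk b l' c) : M.IsWalk a (l ++ l') c := by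
  induction l generalizing a with
  | nil => cases h; exact h'
  | cons d l ih => exact ⟨h.1, ih h.2⟩

/-- A simple path does not contain an edge in both directions. -/
theorem IsWalk.inv_notMem {M : PlaneGraph.{u}} {a b : M.Vertex} {l : List M.Dart}
    (h : M.IsWalk a l b) (hs : (a :: l.map M.tgt).Nodup) :
    ∀ d ∈ l, M.θ d ∉ l := by
  induction l generalizing a with
  | nil => simp
  | cons e l ih =>
    obtain ⟨rfl, h2⟩ := h
    rw [List.nodup_cons] at hs
    have key : M.θ e ∉ l := fun hmem => hs.1 (by
      rw [List.map_cons]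
      refine List.mem_cons_of_mem _ (List.mem_map.2 ⟨_, hmem, ?_⟩)
      simp [tgt, M.θ_invol])
    intro d hd hd'
    rcases List.mem_cons.1 hd with rfl | hd
    · rcases List.mem_cons.1 hd' with h3 | h3
      · exact M.θ_ne _ h3
      · exact key h3
    · rcases List.mem_cons.1 hd' with h3 | h3
      · apply key
        rw [← h3, M.θ_invol]
        exact hd
      · exact ih h2 hs.2 d hd h3

namespace CutPath

variable {M : PlaneGraph.{u}} {v₀ v₁ v₂ : M.Vertex} (P : CutPath M v₀ v₁ v₂)

/-- `P₁`: the darts on the path from `v₁` to `v₀`. -/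
def P₁ : Set M.Dart := {d | d ∈ P.l₁}

/-- `P₁'`: the inverses of the darts in `P₁`. -/
def P₁' : Set M.Dart := {d | M.θ d ∈ P.l₁}

/-- `P₂`: the darts on the path from `v₂` to `v₀` (the list `l₂` runs in the other direction). -/
def P₂ : Set M.Dart := {d | M.θ d ∈ P.l₂}

/-- `P₂'`: the inverses of the darts in `P₂`. -/
def P₂' : Set M.Dart := {d | d ∈ P.l₂}

end CutPath

/-! ## Applying a decoration -/

/-- The double chambers `c_e` of `G` (pairs of chambers sharing a side of type 0) are in bijection
with the darts `e` of `G`. -/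
abbrev DoubleChamber (G : PlaneGraph.{u}) : Type u := G.Dart

/-- `s₁(c_e) = c_{θ(e)}`, whose orbits correspond to the vertices of type 1 (the edges of `G`). -/
def s₁ (G : PlaneGraph.{u}) : Equiv.Perm G.DoubleChamber := G.θ

/-- `s₂(c_e) = c_{σ⁻¹θ(e)}`, whose orbits correspond to the vertices of type 2 (the faces of
`G`). -/
def s₂ (G : PlaneGraph.{u}) : Equiv.Perm G.DoubleChamber := G.σ⁻¹ * G.θ

open scoped Classical in
/-- The operation `s_{P,e}` on the double chambers of `G`. -/
noncomputable def CutPath.s {M : PlaneGraph.{u}} {v₀ v₁ v₂ : M.Vertex}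
    (P : CutPath M v₀ v₁ v₂) (G : PlaneGraph.{v}) (e : M.Dart) : Equiv.Perm G.DoubleChamber :=
  if e ∈ P.P₂ then G.s₂
  else if e ∈ P.P₁ then G.s₁⁻¹
  else if e ∈ P.P₂' then G.s₂⁻¹
  else if e ∈ P.P₁' then G.s₁
  else 1

theorem CutPath.s_inv {M : PlaneGraph.{u}} {v₀ v₁ v₂ : M.Vertex}
    (P : CutPath M v₀ v₁ v₂) (G : PlaneGraph.{v}) (e : M.Dart) :
    P.s G (M.θ e) = (P.s G e)⁻¹ := by
  have h := (P.walk₁.append P.walk₂).inv_notMem P.simple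
  have hd : ∀ d ∈ P.l₁, d ∉ P.l₂ := fun d h1 h2 => by
    have hs := (List.nodup_cons.1 P.simple).2
    rw [List.map_append, List.nodup_append] at hs
    exact hs.2.2 _ (List.mem_map_of_mem h1) _ (List.mem_map_of_mem h2) rfl
  have h1 := h e
  have h2 := hd e
  have h3 := hd (M.θ e)
  simp only [List.mem_append] at h1
  by_cases a1 : e ∈ P.l₁ <;> by_cases a2 : e ∈ P.l₂ <;> by_cases a3 : M.θ e ∈ P.l₁ <;>
    by_cases a4 : M.θ e ∈ P.l₂ <;>
    simp_all [CutPath.s, CutPath.P₁, CutPath.P₁', CutPath.P₂, CutPath.P₂', M.θ_invol]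

/-- The application `D_P(G) = (E × C, σ_P, θ_P)` of a decoration `D` with simple path `P` to `G`,
where `σ_P(e, c) = (σ(e), s_{P,e}(c))` and `θ_P(e, c) = (θ(e), s_{P,e}(c))`. -/
noncomputable def application {D : PlaneGraph.{u}} {v₀ v₁ v₂ : D.Vertex}
    (P : CutPath D v₀ v₁ v₂) (G : PlaneGraph.{v}) : PlaneGraph.{max u v} where
  Dart := D.Dart × G.DoubleChamber
  σ := Equiv.prodShear D.σ (P.s G)
  θ := Equiv.prodShear D.θ (P.s G)
  θ_invol := by
    rintro ⟨e, c⟩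
    simp [D.θ_invol, P.s_inv]
  θ_ne := by
    rintro ⟨e, c⟩ h
    exact D.θ_ne e (congrArg Prod.fst h)

end PlaneGraph

/-! ## Tilings and lopsp operations -/

/-- A connected tiling of the Euclidean plane `ℂ`, given by its graph together with a realization
of its chamber system as a subdivision of the plane into (curvilinear) triangles. The
triangles are parametrized by barycentric coordinates, indexed by the types of their corners.
They are locally finite, cover the plane, and meet exactly along the sides and corners that the
graph prescribes. (A realization may reverse the orientation: passing to the mirror image only
replaces the rotations below by their inverses, which generate the same group.) -/
structure Tiling where
  graph : PlaneGraph.{u}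
  connected : graph.Connected
  point : graph.Chamber → stdSimplex ℝ (Fin 3) → ℂ
  continuous_point : ∀ c, Continuous (point c)
  locallyFinite : LocallyFinite fun c => Set.range (point c)
  covers : ∀ z, ∃ c x, point c x = z
  point_eq_iff : ∀ c x c' x', point c x = point c' x' ↔ x = x' ∧ graph.SharePoint x c c'

namespace Tiling

/-- The point of the plane at which a dart of the chamber system starts. -/
noncomputable def srcPoint (T : Tiling.{u}) (d : T.graph.chamberSystem.Dart) : ℂ :=
  T.point (PlaneGraph.ChamberDart.base d, true) (stdSimplex.vertex (PlaneGraph.ChamberDart.srcType d))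

/-- The automorphism `φ` of the graph of `T` is induced by the map `ρ` of the plane, which is
therefore a symmetry of the tiling. -/
def Induces (T : Tiling.{u}) (ρ : ℂ → ℂ) (φ : T.graph.Iso T.graph) : Prop :=
  ∀ e b x, T.point (φ.toEquiv e, b) x = ρ (T.point (e, b) x)

end Tiling

/-- The rotation of the plane with centre `c` by the angle `α` in clockwise direction. -/
noncomputable def clockwiseRotation (c : ℂ) (α : ℝ) (z : ℂ) : ℂ :=
  c + Complex.exp (-(α * Complex.I)) * (z - c)

/-- A local orientation-preserving symmetry preserving operation `(T, v₀, v₂)`: the clockwise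
rotations by 120 degrees around `v₀` and by 60 degrees around `v₂` are symmetries of `T`. The
automorphisms `ρ₀` and `ρ₂` are those induced by these two rotations. -/
structure LopspOperation where
  T : Tiling.{u}
  v₀ : ℂ
  v₂ : ℂ
  ρ₀ : T.graph.Iso T.graph
  ρ₂ : T.graph.Iso T.graph
  induces₀ : T.Induces (clockwiseRotation v₀ (2 * Real.pi / 3)) ρ₀
  induces₂ : T.Induces (clockwiseRotation v₂ (Real.pi / 3)) ρ₂

namespace LopspOperation

variable (O : LopspOperation.{u})

/-- `v₁` is the midpoint of `v₀` and `v₀' = ρ_{v₂}(v₀)`. -/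
noncomputable def v₁ : ℂ := (O.v₀ + clockwiseRotation O.v₂ (Real.pi / 3) O.v₀) / 2

/-- `ρ_{v₂} ∘ ρ_{v₀}` is the rotation by 180 degrees with centre `v₁`. -/
theorem rotation_comp (z : ℂ) :
    clockwiseRotation O.v₂ (Real.pi / 3) (clockwiseRotation O.v₀ (2 * Real.pi / 3) z)
      = clockwiseRotation O.v₁ Real.pi z := by
  have h3 : Complex.exp (-(((Real.pi / 3 : ℝ) : ℂ) * Complex.I)) ^ 3 = -1 := by
    rw [← Complex.exp_nat_mul]
    have : ((3 : ℕ) : ℂ) * -(((Real.pi / 3 : ℝ) : ℂ) * Complex.I)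
        = -(Real.pi * Complex.I) := by push_cast; ring
    rw [this, Complex.exp_neg, Complex.exp_pi_mul_I]
    norm_num
  have h2 : Complex.exp (-(((2 * Real.pi / 3 : ℝ) : ℂ) * Complex.I))
      = Complex.exp (-(((Real.pi / 3 : ℝ) : ℂ) * Complex.I)) ^ 2 := by
    rw [← Complex.exp_nat_mul]
    congr 1
    push_cast
    ring
  have h1 : Complex.exp (-((Real.pi : ℂ) * Complex.I)) = -1 := by
    rw [Complex.exp_neg, Complex.exp_pi_mul_I]
    norm_num
  simp only [v₁, clockwiseRotation, h2, h1]
  linear_combination (z - O.v₀) * h3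

/-- The group `⟨ρ_{v₀}, ρ_{v₂}⟩`, acting on the darts of the chamber system of `T`. -/
def group : Subgroup (Equiv.Perm O.T.graph.chamberSystem.Dart) :=
  Subgroup.closure {PlaneGraph.ChamberDart.mapPerm O.ρ₀.toEquiv,
    PlaneGraph.ChamberDart.mapPerm O.ρ₂.toEquiv}

theorem group_induction {p : Equiv.Perm O.T.graph.chamberSystem.Dart → Prop}
    (h : ∀ φ : O.T.graph.Iso O.T.graph, p (PlaneGraph.ChamberDart.mapPerm φ.toEquiv))
    (one : p 1) (mul : ∀ f g, p f → p g → p (f * g)) (inv : ∀ f, p f → p f⁻¹) :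
    ∀ g ∈ O.group, p g := by
  intro g hg
  induction hg using Subgroup.closure_induction with
  | mem x hx =>
    rcases hx with rfl | rfl
    · exact h _
    · exact h _
  | one => exact one
  | mul x y _ _ hx hy => exact mul _ _ hx hy
  | inv x _ hx => exact inv _ hx

theorem group_σ : ∀ g ∈ O.group, ∀ d,
    g (O.T.graph.chamberSystem.σ d) = O.T.graph.chamberSystem.σ (g d) := by
  refine O.group_induction (p := fun g => ∀ d, g (O.T.graph.chamberSystem.σ d) = O.T.graph.chamberSystem.σ (g d)) ?_ ?_ ?_ ?_
  · intro φ d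
    have h1 : ∀ e, φ.toEquiv (O.T.graph.σ e) = O.T.graph.σ (φ.toEquiv e) := φ.map_σ
    have h2 : ∀ e, φ.toEquiv (O.T.graph.θ e) = O.T.graph.θ (φ.toEquiv e) := φ.map_θ
    have h3 : ∀ e, φ.toEquiv ((O.T.graph.σ * O.T.graph.θ)⁻¹ e)
        = (O.T.graph.σ * O.T.graph.θ)⁻¹ (φ.toEquiv e) := fun e => by
      rw [Equiv.Perm.eq_inv_iff_eq, Equiv.Perm.mul_apply, ← h2, ← h1]
      simp
    cases d with
    | vf e => rfl
    | ve e => exact congrArg PlaneGraph.ChamberDart.vf (h1 e)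
    | ev e => rfl
    | ef e => exact congrArg PlaneGraph.ChamberDart.ev (h2 e)
    | fe e => rfl
    | fv e => exact congrArg PlaneGraph.ChamberDart.fe (h3 e)
  · intro d; rfl
  · intro f g hf hg d
    simp [hf, hg]
  · intro f hf d
    rw [Equiv.Perm.inv_eq_iff_eq, hf]
    simp

theorem group_θ : ∀ g ∈ O.group, ∀ d,
    g (O.T.graph.chamberSystem.θ d) = O.T.graph.chamberSystem.θ (g d) := by
  refine O.group_induction (p := fun g => ∀ d, g (O.T.graph.chamberSystem.θ d) = O.T.graph.chamberSystem.θ (g d)) ?_ ?_ ?_ ?_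
  · intro φ d
    cases d <;> rfl
  · intro d; rfl
  · intro f g hf hg d
    simp [hf, hg]
  · intro f hf d
    rw [Equiv.Perm.inv_eq_iff_eq, hf]
    simp

theorem group_srcType : ∀ g ∈ O.group, ∀ d,
    PlaneGraph.ChamberDart.srcType (g d) = PlaneGraph.ChamberDart.srcType d := by
  refine O.group_induction (p := fun g => ∀ d,
    PlaneGraph.ChamberDart.srcType (g d) = PlaneGraph.ChamberDart.srcType d) ?_ ?_ ?_ ?_
  · intro φ d
    exact PlaneGraph.ChamberDart.srcType_map _ d
  · intro d; rfl
  · intro f g hf hg d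
    exact (hf (g d)).trans (hg d)
  · intro f hf d
    rw [← hf (f⁻¹ d)]
    simp

theorem group_edgeType : ∀ g ∈ O.group, ∀ d,
    PlaneGraph.ChamberDart.edgeType (g d) = PlaneGraph.ChamberDart.edgeType d := by
  refine O.group_induction (p := fun g => ∀ d,
    PlaneGraph.ChamberDart.edgeType (g d) = PlaneGraph.ChamberDart.edgeType d) ?_ ?_ ?_ ?_
  · intro φ d
    exact PlaneGraph.ChamberDart.edgeType_map _ d
  · intro d; rfl
  · intro f g hf hg d
    exact (hf (g d)).trans (hg d)
  · intro f hf d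
    rw [← hf (f⁻¹ d)]
    simp

/-- The plane graph of the double chamber decoration of `O`: the quotient of the chamber system of
`T` by `⟨ρ_{v₀}, ρ_{v₂}⟩`. -/
def decoration : PlaneGraph.{u} :=
  O.T.graph.chamberSystem.quotient O.group O.group_σ O.group_θ (by
    intro g hg d h
    have h1 := O.group_srcType g hg d
    rw [h] at h1
    cases d with
    | ve e => exact absurd h1 (by decide : (1 : Fin 3) ≠ 0)
    | ev e => exact absurd h1 (by decide : (0 : Fin 3) ≠ 1)
    | vf e => exact absurd h1 (by decide : (2 : Fin 3) ≠ 0)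
    | fv e => exact absurd h1 (by decide : (0 : Fin 3) ≠ 2)
    | ef e => exact absurd h1 (by decide : (2 : Fin 3) ≠ 1)
    | fe e => exact absurd h1 (by decide : (1 : Fin 3) ≠ 2))

/-- The class in the decoration of a dart of the chamber system of `T`. -/
def proj (d : O.T.graph.chamberSystem.Dart) : O.decoration.Dart :=
  Quotient.mk (MulAction.orbitRel O.group O.T.graph.chamberSystem.Dart) d

/-- The labelling of the darts of the decoration by their types. -/
def label : O.decoration.Dart → Fin 3 :=
  Quotient.lift PlaneGraph.ChamberDart.edgeType (by
    rintro a b ⟨g, rfl⟩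
    exact O.group_edgeType g.1 g.2 b)

/-- The vertex `w` of the decoration is the class of the vertex of the chamber system of `T`
located at the point `z` of the plane. -/
def IsVertexAt (z : ℂ) (w : O.decoration.Vertex) : Prop :=
  ∃ d, O.T.srcPoint d = z ∧ O.decoration.src (O.proj d) = w

end LopspOperation

/-!
An isomorphism from `D_P(G)` to `D_Q(G)` over the identity of `D` has the form
`(e, c) ↦ (e, k_e(c))`, and it commutes with `σ` and `θ` exactly if `k` is constant on the faces of
`D` (the orbits of `σθ`) and `k_{θe} s_{P,e} = s_{Q,e} k_e`. So `s_P` and `s_Q` are regarded as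
voltages on the dual graph of `D`, and the theorem says that they are gauge equivalent
(`PlaneGraph.GaugeEquiv`). Both are images of voltages in the free group on `α` and `β` under
`α ↦ s₁`, `β ↦ s₂⁻¹`, and the equivalence is proved there.

Topologically, `D` is a sphere, both voltages have trivial monodromy away from `v₀`, `v₁`, `v₂`, and
cutting the sphere along `P` leaves a disc. Hence the voltage of `Q` is gauge equivalent to one
supported on `P` (`IsWalk.exists_gaugeEquiv_supportedOn`), which is constant on both parts of `P`.
Its monodromies at `v₁`, `v₂`, `v₀` are conjugate to those of the voltage of `Q`, namely `α⁻¹`, `β⁻¹`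
and `βα`. In a free group this determines the two constants up to a common conjugation
(`FreeGroup.exists_simultaneous_conj`, the algebraic form of the triviality of the pure mapping class
group of the sphere with three punctures).

That the complement of `P` is a disc is used in the following form. Extend `P` to a spanning tree of
`D` (`Grows`). A dual cycle avoiding this tree would be a closed integral `1`-form that vanishes on
the tree; if closed forms are exact, such a form is zero. So the dual edges off the tree form a
forest, the voltage can be gauged away on them (`exists_gauge_eq_one`), and then the leaves of the
tree are pruned until only `P` is left (`Grows.eq_one`).

Closed forms on `D` are exact (`LopspOperation.decoration_closedFormsExact`) because the plane is
simply connected: on the chamber system of `T`, a primitive modulo `1`, interpolated affinely on the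
chambers, is a continuous map from the plane to `ℝ/ℤ`, which lifts to `ℝ`. The two rotations have
fixed points, so they do not change the lift, and it descends to `D`. Finally, `D` is finite since the
group contains a lattice of translations, except if the centres `v₀` and `v₂` coincide; in that case
all paths are empty.
-/

/-! ### Conjugacy in the free group of rank two -/

namespace FreeGroup

/-- A cyclically reduced word has minimal length in its conjugacy class: the length of its `n`-th
power grows like `n` times its own length, while conjugation changes lengths by a bounded amount. -/
theorem IsCyclicallyReduced.length_le_norm_of_isConj {α : Type*} [DecidableEq α]
    {L : List (α × Bool)} (hL : IsCyclicallyReduced L) {y : FreeGroup α}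
    (h : IsConj (mk L) y) : L.length ≤ y.norm := by
  obtain ⟨c, hc⟩ := isConj_iff.1 h
  have norm_pow_le : ∀ n : ℕ, (y ^ n).norm ≤ n * y.norm := by
    intro n
    induction n with
    | zero => simp
    | succ n ih =>
      rw [pow_succ]
      have := norm_mul_le (y ^ n) y
      linarith
  have norm_pow : ∀ n : ℕ, (mk L ^ n).norm = n * L.length := by
    intro n
    rw [norm, toWord_pow, toWord_mk, hL.isReduced.reduce_eq,
      (hL.flatten_replicate n).isReduced.reduce_eq]
    simp
  by_contra! hlt
  set n := 2 * c.norm + 1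
  have h1 : mk L ^ n = c⁻¹ * y ^ n * c := by
    rw [← hc, conj_pow]
    group
  have h2 : (mk L ^ n).norm ≤ c.norm + n * y.norm + c.norm := by
    rw [h1]
    have := norm_mul_le (c⁻¹ * y ^ n) c
    have := norm_mul_le c⁻¹ (y ^ n)
    have := norm_pow_le n
    rw [norm_inv_eq] at *
    linarith
  rw [norm_pow] at h2
  have h3 := Nat.mul_le_mul_left n hlt
  rw [Nat.mul_succ] at h3
  omega

theorem IsReduced.invRev {α : Type*} [DecidableEq α] {L : List (α × Bool)} (h : IsReduced L) :
    IsReduced (FreeGroup.invRev L) :=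
  .of_reduce_eq (by rw [reduce_invRev, h.reduce_eq])

/-- In the free group on `α = of false` and `β = of true`, if `α · uβu⁻¹` is conjugate to `αβ`,
then `u` lies in `⟨α⟩⟨β⟩`. Consequently an automorphism that maps `α`, `β` and `αβ` to conjugates
of themselves is inner. -/
theorem eq_zpow_mul_zpow_of_isConj {u : FreeGroup Bool}
    (h : IsConj (of false * (u * of true * u⁻¹)) (of false * of true)) :
    ∃ m n : ℤ, u = of false ^ m * of true ^ n := by
  -- Replace `u` by a shortest element of its double coset.
  obtain ⟨u₀, ⟨m, n, rfl⟩, hmin⟩ : ∃ u₀ : FreeGroup Bool,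
      (∃ m n : ℤ, u = of false ^ m * u₀ * of true ^ n) ∧
      ∀ u₁ : FreeGroup Bool, (∃ m n : ℤ, u = of false ^ m * u₁ * of true ^ n) →
        u₀.norm ≤ u₁.norm := by
    obtain ⟨x, hx, hm⟩ := WellFounded.has_min (measure (norm (α := Bool))).wf
      {x | ∃ m n : ℤ, u = of false ^ m * x * of true ^ n} ⟨u, 0, 0, by simp⟩
    exact ⟨x, hx, fun y hy => not_lt.1 (hm y hy)⟩
  have h' : IsConj (of false * (u₀ * of true * u₀⁻¹)) (of false * of true) := by
    refine IsConj.trans (isConj_iff.2 ⟨of false ^ m, ?_⟩) h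
    group
  suffices u₀ = 1 by exact ⟨m, n, by rw [this, mul_one]⟩
  by_contra hu
  set w := u₀.toWord with hw
  have hw0 : w ≠ [] := by simpa [hw, toWord_eq_nil_iff] using hu
  have hmk : mk w = u₀ := mk_toWord
  have hred : IsReduced w := isReduced_toWord
  have hhead : ∀ a ∈ w.head?, a.1 = true := by
    intro a ha
    by_contra hne
    obtain ⟨g, b⟩ := a
    obtain rfl : g = false := by simpa using hne
    obtain ⟨t, ht⟩ : ∃ t, w = (false, b) :: t := by
      cases hw' : w with
      | nil => exact absurd hw' hw0
      | cons x t => rw [hw'] at ha; simp at ha; exact ⟨t, by rw [ha]⟩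
    have h1 : u₀ = of false ^ (if b then 1 else -1 : ℤ) * mk t := by
      rw [← hmk, ht]
      cases b <;> simp [of, inv_mk, FreeGroup.invRev]
    have h2 := hmin (mk t) ⟨m + (if b then 1 else -1), n, by rw [h1, zpow_add]; group⟩
    have h3 : (mk t).norm ≤ t.length := norm_mk_le
    have h4 : u₀.norm = t.length + 1 := by rw [norm, ← hw, ht]; simp
    omega
  have hlast : ∀ a ∈ w.getLast?, a.1 = false := by
    intro a ha
    by_contra hne
    obtain ⟨g, b⟩ := a
    obtain rfl : g = true := by simpa using hne
    obtain ⟨t, ht⟩ : ∃ t, w = t ++ [(true, b)] := List.mem_getLast?_eq_getLast ha |> fun ⟨hn, he⟩ =>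
      ⟨w.dropLast, by rw [he]; exact (List.dropLast_append_getLast hn).symm⟩
    have h1 : u₀ = mk t * of true ^ (if b then 1 else -1 : ℤ) := by
      rw [← hmk, ht]
      cases b <;> simp [of, inv_mk, FreeGroup.invRev]
    have h2 := hmin (mk t) ⟨m, (if b then 1 else -1) + n, by rw [h1, zpow_add]; group⟩
    have h3 : (mk t).norm ≤ t.length := norm_mk_le
    have h4 : u₀.norm = t.length + 1 := by rw [norm, ← hw, ht]; simp
    omega
  have hhead' : ∀ a ∈ (FreeGroup.invRev w).head?, a.1 = false := by
    intro a ha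
    rw [FreeGroup.invRev, List.head?_reverse, List.getLast?_map] at ha
    obtain ⟨x, hx, rfl⟩ := Option.map_eq_some_iff.1 ha
    exact hlast x hx
  have hlast' : ∀ a ∈ (FreeGroup.invRev w).getLast?, a.1 = true := by
    intro a ha
    rw [FreeGroup.invRev, List.getLast?_reverse, List.head?_map] at ha
    obtain ⟨x, hx, rfl⟩ := Option.map_eq_some_iff.1 ha
    exact hhead x hx
  have hinv0 : FreeGroup.invRev w ≠ [] := by
    intro h0
    have := congrArg List.length h0
    rw [invRev_length] at this
    exact hw0 (List.length_eq_zero_iff.1 this)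
  -- No letters cancel in `α · uβu⁻¹`, not even cyclically, so this element has minimal length in its
  -- conjugacy class, and it is longer than `αβ`.
  have hcyc : IsCyclicallyReduced
      ([(false, true)] ++ (w ++ ([(true, true)] ++ FreeGroup.invRev w))) := by
    rw [isCyclicallyReduced_iff]
    constructor
    · rw [IsReduced, List.isChain_append, List.isChain_append, List.isChain_append]
      refine ⟨List.isChain_singleton _, ⟨hred, ⟨List.isChain_singleton _, hred.invRev, ?_⟩, ?_⟩, ?_⟩
      · intro x hx y hy
        have := hhead' y hy
        simp at hx
        simp [← hx, this]
      · intro x hx y hy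
        have := hlast x hx
        simp at hy
        simp [← hy, this]
      · intro x hx y hy
        rw [List.head?_append_of_ne_nil _ hw0] at hy
        have := hhead y hy
        simp at hx
        simp [← hx, this]
    · intro x hx y hy
      rw [← List.append_assoc, ← List.append_assoc, List.getLast?_append_of_ne_nil _ hinv0] at hx
      have := hlast' x hx
      simp at hy
      simp [← hy, this]
  have hlen := hcyc.length_le_norm_of_isConj (y := of false * of true) (by
    have : mk ([(false, true)] ++ (w ++ ([(true, true)] ++ FreeGroup.invRev w)))
        = of false * (u₀ * of true * u₀⁻¹) := by
      rw [← mul_mk, ← mul_mk, ← mul_mk, ← inv_mk, hmk, mul_assoc u₀]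
      rfl
    rw [this]
    exact h')
  have h2 := norm_mul_le (of false) (of true)
  rw [norm_of, norm_of] at h2
  have h3 : 0 < w.length := List.length_pos_iff.2 hw0
  simp [invRev_length] at hlen
  omega

/-- Two conjugates of `α` and `β` whose product is conjugate to `αβ` are conjugate to `α` and `β`
by the same element. -/
theorem exists_simultaneous_conj {g h : FreeGroup Bool}
    (H : IsConj (h * of true * h⁻¹ * (g * of false * g⁻¹)) (of true * of false)) :
    ∃ k, g * of false * g⁻¹ = k * of false * k⁻¹ ∧ h * of true * h⁻¹ = k * of true * k⁻¹ := by
  have swap : ∀ x y : FreeGroup Bool, IsConj (x * y) (y * x) := fun x y =>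
    isConj_iff.2 ⟨x⁻¹, by group⟩
  obtain ⟨m, n, hu⟩ := eq_zpow_mul_zpow_of_isConj (u := g⁻¹ * h) (by
    refine IsConj.trans ?_ (H.trans (swap _ _))
    refine IsConj.trans (isConj_iff.2 ⟨g, ?_⟩) (swap (g * of false * g⁻¹) _)
    group)
  refine ⟨g * of false ^ m, by group, ?_⟩
  obtain rfl : h = g * (of false ^ m * of true ^ n) := by rw [← hu]; group
  group

end FreeGroup

namespace PlaneGraph

variable {M : PlaneGraph.{u}} {A : Type*} [Group A]

/-! ### Sources and targets of darts -/

theorem src_σ (e : M.Dart) : M.src (M.σ e) = M.src e :=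
  Quotient.sound (Equiv.Perm.sameCycle_apply_left.2 (Equiv.Perm.SameCycle.refl _ _))

theorem tgt_θ (e : M.Dart) : M.tgt (M.θ e) = M.src e := by rw [tgt, M.θ_invol]

theorem src_iterate_σ (n : ℕ) (e : M.Dart) : M.src (M.σ^[n] e) = M.src e := by
  induction n with
  | zero => rfl
  | succ n ih => rw [Function.iterate_succ_apply', src_σ, ih]

theorem exists_iterate_of_src_eq [Finite M.Dart] {e f : M.Dart} (h : M.src e = M.src f) :
    ∃ n < Function.minimalPeriod M.σ e, M.σ^[n] e = f := by
  obtain ⟨n, hn⟩ := (Quotient.exact h : M.σ.SameCycle e f).exists_nat_pow_eq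
  have hp : e ∈ Function.periodicPts M.σ := M.σ.injective.mem_periodicPts e
  refine ⟨n % Function.minimalPeriod M.σ e,
    Nat.mod_lt _ (Function.minimalPeriod_pos_of_mem_periodicPts hp), ?_⟩
  rw [Function.iterate_mod_minimalPeriod_eq, ← Equiv.Perm.coe_pow, hn]

/-! ### Voltages and their monodromy -/

/-- A voltage on `M` with values in a group: inverse darts carry inverse values. The value at `e`
belongs to the crossing of `e` from the face on its left to the face on its right. -/
def IsVoltage (s : M.Dart → A) : Prop := ∀ e, s (M.θ e) = (s e)⁻¹

/-- Two voltages are gauge equivalent if they differ by a function `k` on the faces. That `k` is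
constant on the orbits of `σθ` is expressed by `k (σ e) = k (θ e)`. -/
def GaugeEquiv (s s' : M.Dart → A) : Prop :=
  ∃ k : M.Dart → A, (∀ e, k (M.σ e) = k (M.θ e)) ∧ ∀ e, k (M.θ e) * s e = s' e * k e

theorem GaugeEquiv.symm {s s' : M.Dart → A} (h : GaugeEquiv s s') : GaugeEquiv s' s := by
  obtain ⟨k, h1, h2⟩ := h
  refine ⟨fun e => (k e)⁻¹, fun e => by simp only [h1], fun e => ?_⟩
  rw [inv_mul_eq_iff_eq_mul, ← mul_assoc, h2]
  group

theorem GaugeEquiv.trans {s s' s'' : M.Dart → A} (h : GaugeEquiv s s') (h' : GaugeEquiv s' s'') :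
    GaugeEquiv s s'' := by
  obtain ⟨k, h1, h2⟩ := h
  obtain ⟨l, h3, h4⟩ := h'
  refine ⟨fun e => l e * k e, fun e => by simp only [h1, h3], fun e => ?_⟩
  rw [mul_assoc, h2, ← mul_assoc, h4, mul_assoc]

theorem GaugeEquiv.map {B : Type*} [Group B] (F : A →* B) {s s' : M.Dart → A}
    (h : GaugeEquiv s s') : GaugeEquiv (fun e => F (s e)) (fun e => F (s' e)) := by
  obtain ⟨k, h1, h2⟩ := h
  exact ⟨fun e => F (k e), fun e => by simp only [h1], fun e => by rw [← map_mul, h2, map_mul]⟩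

/-- The product of the voltages of `e, σ e, …, σ^(n-1) e`, in this order from right to left. -/
def turn (s : M.Dart → A) : ℕ → M.Dart → A
  | 0, _ => 1
  | n + 1, e => s (M.σ^[n] e) * turn s n e

/-- The product of the voltages along one turn around the source of `e`, starting with `e`. -/
noncomputable def monodromy (s : M.Dart → A) (e : M.Dart) : A :=
  turn s (Function.minimalPeriod M.σ e) e

theorem turn_add (s : M.Dart → A) (m n : ℕ) (e : M.Dart) :
    turn s (m + n) e = turn s m (M.σ^[n] e) * turn s n e := by
  induction m with
  | zero => simp [turn]
  | succ m ih => rw [Nat.succ_add, turn, ih, turn, mul_assoc, Function.iterate_add_apply]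

theorem turn_eq_one {s : M.Dart → A} {n : ℕ} {e : M.Dart} (h : ∀ i < n, s (M.σ^[i] e) = 1) :
    turn s n e = 1 := by
  induction n with
  | zero => rfl
  | succ n ih => rw [turn, h n n.lt_succ_self, ih fun i hi => h i (hi.trans n.lt_succ_self), one_mul]

theorem turn_gauge {s s' k : M.Dart → A} (h1 : ∀ e, k (M.σ e) = k (M.θ e))
    (h2 : ∀ e, k (M.θ e) * s e = s' e * k e) (n : ℕ) (e : M.Dart) :
    k (M.σ^[n] e) * turn s n e = turn s' n e * k e := by
  induction n with
  | zero => simp [turn]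
  | succ n ih =>
    rw [turn, turn, Function.iterate_succ_apply', h1, ← mul_assoc, h2, mul_assoc, ih, mul_assoc]

theorem isConj_monodromy_of_gaugeEquiv {s s' : M.Dart → A} (h : GaugeEquiv s s') (e : M.Dart) :
    IsConj (monodromy s e) (monodromy s' e) := by
  obtain ⟨k, h1, h2⟩ := h
  refine isConj_iff.2 ⟨k e, mul_inv_eq_iff_eq_mul.2 ?_⟩
  have := turn_gauge h1 h2 (Function.minimalPeriod M.σ e) e
  rwa [Function.iterate_minimalPeriod] at this

theorem isConj_monodromy_of_src_eq [Finite M.Dart] (s : M.Dart → A) {e f : M.Dart}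
    (h : M.src e = M.src f) : IsConj (monodromy s e) (monodromy s f) := by
  obtain ⟨n, -, rfl⟩ := exists_iterate_of_src_eq h
  refine isConj_iff.2 ⟨turn s n e, mul_inv_eq_iff_eq_mul.2 ?_⟩
  rw [monodromy, monodromy,
    Function.minimalPeriod_apply_iterate (M.σ.injective.mem_periodicPts e), ← turn_add, add_comm,
    turn_add, Function.iterate_minimalPeriod]

theorem monodromy_eq_of_support [Finite M.Dart] {s : M.Dart → A} {e : M.Dart}
    (h : ∀ f, M.src f = M.src e → f ≠ e → s f = 1) : monodromy s e = s e := by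
  have hp : 0 < Function.minimalPeriod M.σ e :=
    Function.minimalPeriod_pos_of_mem_periodicPts (M.σ.injective.mem_periodicPts e)
  obtain ⟨n, hn⟩ := Nat.exists_eq_succ_of_ne_zero hp.ne'
  rw [monodromy, hn, Nat.succ_eq_add_one, turn_add, turn_eq_one, one_mul]
  · simp [turn]
  · intro i hi
    rw [← Function.iterate_add_apply]
    refine h _ (src_iterate_σ _ _) fun h0 => ?_
    have := (Function.iterate_eq_iterate_iff_of_lt_minimalPeriod (m := i + 1) (n := 0)
      (by omega) hp).1 h0
    omega

/-- The monodromy at a vertex where only two darts `e` and `f` have a nontrivial voltage. -/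
theorem monodromy_eq_mul_of_support [Finite M.Dart] {s : M.Dart → A} {e f : M.Dart}
    (hf : M.src f = M.src e) (hef : f ≠ e)
    (h : ∀ g, M.src g = M.src e → g ≠ e → g ≠ f → s g = 1) : monodromy s e = s f * s e := by
  obtain ⟨n, hn, rfl⟩ := exists_iterate_of_src_eq hf.symm
  obtain ⟨n, rfl⟩ := Nat.exists_eq_succ_of_ne_zero (n := n) (by rintro rfl; exact hef rfl)
  obtain ⟨m, hm⟩ := Nat.exists_eq_add_of_lt hn
  have key : ∀ i < Function.minimalPeriod M.σ e, i ≠ 0 → i ≠ n + 1 → s (M.σ^[i] e) = 1 := by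
    intro i hi h0 h1
    refine h _ (src_iterate_σ _ _) (fun h2 => h0 ?_) (fun h2 => h1 ?_)
    · exact (Function.iterate_eq_iterate_iff_of_lt_minimalPeriod (n := 0) hi (by omega)).1 h2
    · exact (Function.iterate_eq_iterate_iff_of_lt_minimalPeriod hi hn).1 h2
  have hper : Function.minimalPeriod M.σ e = m + (1 + (n + 1)) := by omega
  rw [monodromy, hper, turn_add, turn_add, turn_add, turn_eq_one, turn_eq_one (n := n)]
  · simp [turn]
  · intro i hi
    rw [← Function.iterate_add_apply]
    exact key _ (by omega) (by omega) (by omega)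
  · intro i hi
    rw [← Function.iterate_add_apply]
    exact key _ (by omega) (by omega) (by omega)

/-! ### Monodromies of voltages supported on a simple path -/

/-- The voltage `s` is trivial on all darts that do not lie on `l` or its reverse. -/
def SupportedOn (s : M.Dart → A) (l : List M.Dart) : Prop :=
  ∀ e, e ∉ l → M.θ e ∉ l → s e = 1

theorem IsWalk.map_src {a b : M.Vertex} {l : List M.Dart} (h : M.IsWalk a l b) :
    l.map M.src ++ [b] = a :: l.map M.tgt := by
  induction l generalizing a with
  | nil => cases h; rfl
  | cons d l ih => rw [List.map_cons, List.cons_append, ih h.2, h.1, List.map_cons]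

theorem IsWalk.of_append {a b : M.Vertex} {l l' : List M.Dart} (h : M.IsWalk a (l ++ l') b) :
    ∃ c, M.IsWalk a l c ∧ M.IsWalk c l' b := by
  induction l generalizing a with
  | nil => exact ⟨a, rfl, h⟩
  | cons d l ih =>
    obtain ⟨c, h1, h2⟩ := ih h.2
    exact ⟨c, ⟨h.1, h1⟩, h2⟩

theorem IsWalk.end_mem {a b : M.Vertex} {d : M.Dart} {l : List M.Dart}
    (h : M.IsWalk a (d :: l) b) : b ∈ (d :: l).map M.tgt := by
  induction l generalizing a d with
  | nil => exact List.mem_singleton.2 (Eq.symm h.2)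
  | cons e l ih => exact List.mem_cons_of_mem _ (ih h.2)

section SimplePath

variable {a b : M.Vertex} {l : List M.Dart} {s : M.Dart → A}

theorem IsWalk.nodup_src (h : M.IsWalk a l b) (hl : (a :: l.map M.tgt).Nodup) :
    (l.map M.src ++ [b]).Nodup := by
  rwa [h.map_src]

theorem IsWalk.eq_of_src_eq (h : M.IsWalk a l b) (hl : (a :: l.map M.tgt).Nodup) {d e : M.Dart}
    (hd : d ∈ l) (he : e ∈ l) (hde : M.src d = M.src e) : d = e :=
  List.inj_on_of_nodup_map (List.nodup_append.1 (h.nodup_src hl)).1 hd he hde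

theorem eq_of_tgt_eq (hl : (a :: l.map M.tgt).Nodup) {d e : M.Dart}
    (hd : d ∈ l) (he : e ∈ l) (hde : M.tgt d = M.tgt e) : d = e :=
  List.inj_on_of_nodup_map (List.nodup_cons.1 hl).2 hd he hde

theorem tgt_ne_start (hl : (a :: l.map M.tgt).Nodup) {d : M.Dart} (hd : d ∈ l) : M.tgt d ≠ a :=
  fun h => (List.nodup_cons.1 hl).1 (h ▸ List.mem_map_of_mem hd)

theorem IsWalk.src_ne_end (h : M.IsWalk a l b) (hl : (a :: l.map M.tgt).Nodup) {d : M.Dart}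
    (hd : d ∈ l) : M.src d ≠ b :=
  (List.nodup_append.1 (h.nodup_src hl)).2.2 _ (List.mem_map_of_mem hd) _ (List.mem_singleton.2 rfl)

/-- At an inner vertex of a simple path, the monodromy compares the voltages of the darts before and
after it. -/
theorem IsWalk.monodromy_inner [Finite M.Dart] (h : M.IsWalk a l b)
    (hl : (a :: l.map M.tgt).Nodup) (hs : IsVoltage s) (hsupp : SupportedOn s l) {d d' : M.Dart}
    (hd : d ∈ l) (hd' : d' ∈ l) (hdd' : M.src d' = M.tgt d) :
    monodromy s (M.θ d) = s d' * (s d)⁻¹ := by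
  rw [← hs d]
  refine monodromy_eq_mul_of_support hdd' (fun h0 => ?_) fun g hg h1 h2 => hsupp g ?_ ?_
  · exact h.inv_notMem hl d hd (h0 ▸ hd')
  · exact fun hgl => h2 (h.eq_of_src_eq hl hgl hd' (hg.trans hdd'.symm))
  · intro hgl
    apply h1
    rw [← eq_of_tgt_eq hl hgl hd ((tgt_θ g).trans hg), M.θ_invol]

theorem IsWalk.monodromy_start [Finite M.Dart] (h : M.IsWalk a l b)
    (hl : (a :: l.map M.tgt).Nodup) (hsupp : SupportedOn s l) {d : M.Dart}
    (hd : d ∈ l) (hda : M.src d = a) : monodromy s d = s d := by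
  refine monodromy_eq_of_support fun g hg h1 => hsupp g ?_ ?_
  · exact fun hgl => h1 (h.eq_of_src_eq hl hgl hd hg)
  · exact fun hgl => tgt_ne_start hl hgl (((tgt_θ g).trans hg).trans hda)

theorem IsWalk.monodromy_end [Finite M.Dart] (h : M.IsWalk a l b)
    (hl : (a :: l.map M.tgt).Nodup) (hs : IsVoltage s) (hsupp : SupportedOn s l) {d : M.Dart}
    (hd : d ∈ l) (hdb : M.tgt d = b) : monodromy s (M.θ d) = (s d)⁻¹ := by
  rw [← hs d]
  refine monodromy_eq_of_support fun g hg h1 => hsupp g ?_ ?_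
  · exact fun hgl => h.src_ne_end hl hgl (hg.trans hdb)
  · intro hgl
    apply h1
    rw [← eq_of_tgt_eq hl hgl hd ((tgt_θ g).trans hg), M.θ_invol]

theorem IsWalk.monodromy_off (h : M.IsWalk a l b) (hsupp : SupportedOn s l) {e : M.Dart}
    (he : M.src e ∉ a :: l.map M.tgt) : monodromy s e = 1 := by
  refine turn_eq_one fun i _ => hsupp _ (fun h1 => he ?_) (fun h1 => he ?_)
  · rw [← src_iterate_σ i e, ← h.map_src]
    exact List.mem_append_left _ (List.mem_map_of_mem h1)
  · rw [← src_iterate_σ i e, ← tgt_θ]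
    exact List.mem_cons_of_mem _ (List.mem_map_of_mem h1)

end SimplePath

theorem _root_.List.eq_head_of_forall_consecutive {α β : Type*} {f : α → β} {d : α} {l : List α}
    (h : ∀ p x y q, d :: l = p ++ x :: y :: q → f x = f y) : ∀ x ∈ d :: l, f x = f d := by
  induction l generalizing d with
  | nil => simp
  | cons e l ih =>
    intro x hx
    rcases List.mem_cons.1 hx with rfl | hx
    · rfl
    · rw [h [] d e l rfl]
      exact ih (fun p x y q hp => h (d :: p) x y q (by rw [hp]; rfl)) x hx

end PlaneGraph

namespace PlaneGraph

variable {M : PlaneGraph.{u}} {A : Type*} [Group A]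

/-! ### Trees and dual trees -/

theorem apply_eq_of_src_eq [Finite M.Dart] {β : Type*} {h : M.Dart → β}
    (hσ : ∀ e, h (M.σ e) = h e) {e f : M.Dart} (hef : M.src e = M.src f) : h e = h f := by
  obtain ⟨n, -, rfl⟩ := exists_iterate_of_src_eq hef
  induction n with
  | zero => rfl
  | succ n ih =>
    rw [Function.iterate_succ_apply', hσ]
    exact ih (src_iterate_σ n e).symm

/-- `Grows S₀ R₀ S R`: the set `S` of vertices and the set `R` of darts arise from `S₀` and `R₀`
by repeatedly attaching a new vertex by a single edge. -/
inductive Grows (S₀ : Set M.Vertex) (R₀ : Set M.Dart) : Set M.Vertex → Set M.Dart → Prop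
  | base : Grows S₀ R₀ S₀ R₀
  | step (S : Set M.Vertex) (R : Set M.Dart) (e : M.Dart) : Grows S₀ R₀ S R → M.src e ∈ S →
      M.tgt e ∉ S → Grows S₀ R₀ (insert (M.tgt e) S) (insert e (insert (M.θ e) R))

theorem exists_dart_leaving (hconn : M.Connected) {S : Set M.Vertex} (hS : S.Nonempty)
    (hne : S ≠ Set.univ) : ∃ e, M.src e ∈ S ∧ M.tgt e ∉ S := by
  by_contra! hall
  have hθ : ∀ e, M.src (M.θ e) ∈ S ↔ M.src e ∈ S := fun e =>
    ⟨fun h => by rw [← tgt_θ]; exact hall _ h, fun h => hall _ h⟩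
  have hg : ∀ g ∈ Subgroup.closure ({M.σ, M.θ} : Set (Equiv.Perm M.Dart)), ∀ e,
      M.src (g e) ∈ S ↔ M.src e ∈ S := by
    intro g hg
    induction hg using Subgroup.closure_induction with
    | mem x hx =>
      rcases hx with rfl | rfl
      · intro e
        rw [src_σ]
      · exact hθ
    | one => exact fun e => Iff.rfl
    | mul x y _ _ hx hy => exact fun e => (hx (y e)).trans (hy e)
    | inv x _ hx => exact fun e => by rw [← hx (x⁻¹ e)]; simp
  obtain ⟨w, hw⟩ := hS
  obtain ⟨e, rfl⟩ := Quotient.exists_rep w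
  apply hne
  ext w'
  obtain ⟨f, rfl⟩ := Quotient.exists_rep w'
  obtain ⟨g, hgm, rfl⟩ := hconn e f
  exact ⟨fun _ => trivial, fun _ => (hg g hgm e).2 hw⟩

theorem Grows.nonempty {S₀ S : Set M.Vertex} {R₀ R : Set M.Dart} (h : Grows S₀ R₀ S R)
    (h₀ : S₀.Nonempty) : S.Nonempty := by
  induction h with
  | base => exact h₀
  | step S R e _ _ _ _ => exact Set.insert_nonempty _ _

theorem exists_grows_univ [Finite M.Dart] (hconn : M.Connected) {S₀ : Set M.Vertex}
    (h₀ : S₀.Nonempty) (R₀ : Set M.Dart) : ∃ R, Grows S₀ R₀ Set.univ R := by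
  have : Finite M.Vertex := Quotient.finite _
  obtain ⟨S, ⟨R, hR⟩, hmax⟩ :=
    Set.Finite.exists_maximal (Set.toFinite {S : Set M.Vertex | ∃ R, Grows S₀ R₀ S R})
      ⟨S₀, R₀, .base⟩
  by_cases hS : S = Set.univ
  · exact ⟨R, hS ▸ hR⟩
  · obtain ⟨e, he, he'⟩ := exists_dart_leaving hconn (hR.nonempty h₀) hS
    exact absurd (hmax ⟨_, .step S R e hR he he'⟩ (Set.subset_insert _ _) (Set.mem_insert _ _)) he'

theorem Grows.subset {S₀ S : Set M.Vertex} {R₀ R : Set M.Dart} (h : Grows S₀ R₀ S R) :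
    S₀ ⊆ S := by
  induction h with
  | base => exact subset_rfl
  | step S R e _ _ _ ih => exact ih.trans (Set.subset_insert _ _)

theorem Grows.base_subset {S₀ S : Set M.Vertex} {R₀ R : Set M.Dart} (h : Grows S₀ R₀ S R) :
    R₀ ⊆ R := by
  induction h with
  | base => exact subset_rfl
  | step S R e _ _ _ ih => exact fun x hx => Or.inr (Or.inr (ih hx))

theorem Grows.inv_mem {S₀ S : Set M.Vertex} {R₀ R : Set M.Dart} (h : Grows S₀ R₀ S R)
    (h₀ : ∀ e ∈ R₀, M.θ e ∈ R₀) : ∀ e ∈ R, M.θ e ∈ R := by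
  induction h with
  | base => exact h₀
  | step S R e _ _ _ ih =>
    rintro f (rfl | rfl | hf)
    · exact Or.inr (Or.inl rfl)
    · exact Or.inl (M.θ_invol e)
    · exact Or.inr (Or.inr (ih f hf))

theorem Grows.src_mem {S₀ S : Set M.Vertex} {R₀ R : Set M.Dart} (h : Grows S₀ R₀ S R)
    (h₀ : ∀ e ∈ R₀, M.src e ∈ S₀) : ∀ e ∈ R, M.src e ∈ S := by
  induction h with
  | base => exact h₀
  | step S R e _ he _ ih =>
    rintro f (rfl | rfl | hf)
    · exact Or.inr he
    · exact Or.inl rfl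
    · exact Or.inr (ih f hf)

/-- A function on the vertices that does not change along the tree is constant if it is constant on
the initial set. -/
theorem Grows.apply_eq [Finite M.Dart] {S₀ S : Set M.Vertex} {R₀ R : Set M.Dart}
    (h : Grows S₀ R₀ S R) {β : Type*} {p : M.Dart → β} (hσ : ∀ e, p (M.σ e) = p e)
    (hp : ∀ e ∈ R, p (M.θ e) = p e) {b : β} (h₀ : ∀ e, M.src e ∈ S₀ → p e = b) :
    ∀ e, M.src e ∈ S → p e = b := by
  induction h with
  | base => exact h₀
  | step S R e _ he _ ih =>
    have ih := ih fun f hf => hp f (Or.inr (Or.inr hf))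
    rintro f (hf | hf)
    · rw [apply_eq_of_src_eq hσ (show M.src f = M.src (M.θ e) from hf), hp e (Or.inl rfl), ih e he]
    · exact ih f hf

/-- A voltage that is trivial outside a tree grown from `S₀` and has trivial monodromy outside `S₀`
is trivial on all the edges that were attached: the last attached edge ends in a leaf, where its
voltage is the monodromy. -/
theorem Grows.eq_one [Finite M.Dart] {S₀ S : Set M.Vertex} {R₀ R : Set M.Dart}
    (h : Grows S₀ R₀ S R) (h₀ : ∀ e ∈ R₀, M.src e ∈ S₀) {s : M.Dart → A} (hs : IsVoltage s)
    (hmono : ∀ e, M.src e ∉ S₀ → monodromy s e = 1) (hR : ∀ e, e ∉ R → s e = 1) :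
    ∀ e, e ∉ R₀ → s e = 1 := by
  induction h with
  | base => exact hR
  | step S R e hg he he' ih =>
    have h1 : s (M.θ e) = 1 := by
      rw [← hmono (M.θ e) fun h => he' (hg.subset h)]
      refine (monodromy_eq_of_support fun f hf hne => hR f ?_).symm
      rintro (rfl | rfl | hfR)
      · exact he' (show M.src (M.θ f) ∈ S from hf ▸ he)
      · exact hne rfl
      · exact he' (show M.src (M.θ e) ∈ S from hf ▸ hg.src_mem h₀ f hfR)
    refine ih fun f hf => ?_
    by_cases hfe : f = e
    · rw [hfe, ← inv_inv (s e), ← hs e, h1, inv_one]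
    by_cases hfe' : f = M.θ e
    · rw [hfe', h1]
    exact hR f (by rintro (h | h | h) <;> contradiction)

/-- The first cohomology of a triangulated surface vanishes: every integral closed `1`-form is
exact. A `1`-form is an antisymmetric function of the darts, and it is closed if its sums over the
triangles vanish. The primitive is a function on the vertices, written as a `σ`-invariant function of
the darts. -/
def ClosedFormsExact (M : PlaneGraph.{u}) : Prop :=
  ∀ ψ : M.Dart → ℤ, (∀ e, ψ (M.θ e) = -ψ e) →
    (∀ e, ψ e + ψ (M.σ (M.θ e)) + ψ (M.σ (M.θ (M.σ (M.θ e)))) = 0) →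
    ∃ h : M.Dart → ℝ, (∀ e, h (M.σ e) = h e) ∧ ∀ e, (ψ e : ℝ) = h (M.θ e) - h e

/-- Two darts are related if one can pass from the face on the left of one to the face on the left
of the other by crossing darts of `L` and their inverses. -/
def DualConnected (L : Set M.Dart) : M.Dart → M.Dart → Prop :=
  Relation.EqvGen fun a b => b = M.σ (M.θ a) ∨ (a ∈ L ∧ b = M.θ a)

open scoped Classical in
/-- The indicator function of the face on the left of `a`, for a triangular face. -/
noncomputable def faceIndicator (a x : M.Dart) : ℤ :=
  (if x = a then 1 else 0) + (if M.σ (M.θ x) = a then 1 else 0) +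
    (if M.σ (M.θ (M.σ (M.θ x))) = a then 1 else 0)

open scoped Classical in
/-- The `1`-form that counts the crossings of the dart `a`. -/
noncomputable def crossing (a x : M.Dart) : ℤ :=
  (if x = a then 1 else 0) - (if x = M.θ a then 1 else 0)

theorem crossing_θ (a x : M.Dart) : crossing a (M.θ x) = -crossing a x := by
  have h1 : M.θ x = a ↔ x = M.θ a :=
    ⟨fun h => by rw [← h, M.θ_invol], fun h => by rw [h, M.θ_invol]⟩
  have h2 : M.θ x = M.θ a ↔ x = a := M.θ.injective.eq_iff
  rw [crossing, crossing, propext h1, propext h2]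
  ring

theorem crossing_boundary (a x : M.Dart) :
    crossing a x + crossing a (M.σ (M.θ x)) + crossing a (M.σ (M.θ (M.σ (M.θ x))))
      = faceIndicator a x - faceIndicator (M.θ a) x := by
  simp only [crossing, faceIndicator]
  ring

theorem faceIndicator_next (htri : ∀ e, M.σ (M.θ (M.σ (M.θ (M.σ (M.θ e))))) = e) (a : M.Dart) :
    faceIndicator (M.σ (M.θ a)) = faceIndicator a := by
  funext x
  have h1 : x = M.σ (M.θ a) ↔ M.σ (M.θ (M.σ (M.θ x))) = a := by
    conv_lhs => rw [← htri x]
    simp only [EmbeddingLike.apply_eq_iff_eq]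
  have h2 : ∀ y, M.σ (M.θ y) = M.σ (M.θ a) ↔ y = a := by simp
  rw [faceIndicator, faceIndicator, propext h1, propext (h2 x), propext (h2 _)]
  ring

/-- A dual path along `L` is a flow from its first to its last face. -/
theorem DualConnected.exists_flow (htri : ∀ e, M.σ (M.θ (M.σ (M.θ (M.σ (M.θ e))))) = e)
    {L : Set M.Dart} {a b : M.Dart} (h : DualConnected L a b) :
    ∃ ψ : M.Dart → ℤ, (∀ x, ψ (M.θ x) = -ψ x) ∧ (∀ x, x ∉ L → M.θ x ∉ L → ψ x = 0) ∧
      ∀ x, ψ x + ψ (M.σ (M.θ x)) + ψ (M.σ (M.θ (M.σ (M.θ x))))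
        = faceIndicator a x - faceIndicator b x := by
  induction h with
  | rel a b h =>
    rcases h with rfl | ⟨ha, rfl⟩
    · exact ⟨fun _ => 0, by simp, by simp, by simp [faceIndicator_next htri]⟩
    · refine ⟨crossing a, crossing_θ a, fun x h1 h2 => ?_, crossing_boundary a⟩
      have h3 : x ≠ a := by rintro rfl; exact h1 ha
      have h4 : x ≠ M.θ a := by rintro rfl; exact h2 (by rwa [M.θ_invol])
      simp [crossing, h3, h4]
  | refl a => exact ⟨fun _ => 0, by simp, by simp, by simp⟩
  | symm a b _ ih =>
    obtain ⟨ψ, h1, h2, h3⟩ := ih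
    refine ⟨fun x => -ψ x, fun x => by simp only [h1], fun x hx hx' => by simp only [h2 x hx hx', neg_zero],
      fun x => by linear_combination -h3 x⟩
  | trans a b c _ _ ih ih' =>
    obtain ⟨ψ, h1, h2, h3⟩ := ih
    obtain ⟨χ, h4, h5, h6⟩ := ih'
    refine ⟨fun x => ψ x + χ x, fun x => by simp only [h1, h4]; ring,
      fun x hx hx' => by simp only [h2 x hx hx', h5 x hx hx', add_zero],
      fun x => by linear_combination h3 x + h6 x⟩

/-- If the edges of `R` connect all vertices and closed forms are exact, then the dual edges outside
`R` form a forest, so every voltage is gauge equivalent to one that is trivial on them. -/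
theorem exists_gauge_eq_one (htri : ∀ e, M.σ (M.θ (M.σ (M.θ (M.σ (M.θ e))))) = e)
    (hexact : ClosedFormsExact M) {R : Set M.Dart} (hRθ : ∀ e ∈ R, M.θ e ∈ R)
    (hR : ∀ p : M.Dart → ℝ, (∀ e, p (M.σ e) = p e) → (∀ e ∈ R, p (M.θ e) = p e) →
      ∀ e f, p e = p f)
    {s : M.Dart → A} (hs : IsVoltage s) (L : Finset M.Dart) (hL : ∀ e ∈ L, e ∉ R) :
    ∃ k : M.Dart → A, (∀ e, k (M.σ e) = k (M.θ e)) ∧ ∀ e ∈ L, k (M.θ e) * s e = k e := by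
  classical
  induction L using Finset.induction_on with
  | empty => exact ⟨fun _ => 1, by simp, by simp⟩
  | insert e L he ih =>
    obtain ⟨k, hk, hkL⟩ := ih fun f hf => hL f (Finset.mem_insert_of_mem hf)
    by_cases hcon : DualConnected (L : Set M.Dart) (M.θ e) e
    · -- `e` would close a dual cycle; unless it is the inverse of an edge of `L`, this cycle is a
      -- nonzero closed form that vanishes on `R`.
      refine ⟨k, hk, fun f hf => ?_⟩
      rcases Finset.mem_insert.1 hf with rfl | hf
      · by_cases hθ : M.θ f ∈ L
        · have := hkL _ hθ
          rw [M.θ_invol, hs] at this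
          rw [← this]
          group
        · exfalso
          obtain ⟨ψ, h1, h2, h3⟩ := hcon.exists_flow htri
          have hψf : ψ f = 0 := h2 f (by simpa using he) (by simpa using hθ)
          obtain ⟨p, hp, hpψ⟩ := hexact (fun x => ψ x + crossing f x)
            (fun x => by rw [h1, crossing_θ]; ring)
            (fun x => by linear_combination h3 x + crossing_boundary f x)
          have hconst := hR p hp fun x hx => by
            have hxf : x ≠ f := by
              rintro rfl
              exact hL x (Finset.mem_insert_self _ _) hx
            have hxf' : x ≠ M.θ f := by
              rintro rfl
              have := hRθ _ hx
              rw [M.θ_invol] at this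
              exact hL f (Finset.mem_insert_self _ _) this
            have h4 := hpψ x
            rw [h2 x (fun h => hL x (Finset.mem_insert_of_mem h) hx)
              (fun h => hL _ (Finset.mem_insert_of_mem h) (hRθ x hx))] at h4
            simp [crossing, hxf, hxf'] at h4
            linarith
          have h5 := hpψ f
          rw [hconst (M.θ f) f, hψf] at h5
          simp [crossing, (M.θ_ne f).symm] at h5
      · exact hkL f hf
    · -- `e` connects two components of the dual graph, and `k` can be adjusted on one of them.
      set C : Set M.Dart := {x | DualConnected (L : Set M.Dart) e x} with hC
      have hstep : ∀ {x y : M.Dart}, DualConnected (L : Set M.Dart) x y → (x ∈ C ↔ y ∈ C) :=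
        fun h => ⟨fun hx => hx.trans _ _ _ h, fun hy => hy.trans _ _ _ (h.symm _ _)⟩
      have heC : e ∈ C := Relation.EqvGen.refl e
      have hθe : M.θ e ∉ C := fun h => hcon (h.symm _ _)
      refine ⟨fun x => if x ∈ C then k (M.θ e) * s e * (k e)⁻¹ * k x else k x, fun x => ?_,
        fun x hx => ?_⟩
      · have h1 : M.θ x ∈ C ↔ M.σ x ∈ C := hstep (.rel _ _ (Or.inl (by rw [M.θ_invol])))
        simp only [h1, hk]
      · rcases Finset.mem_insert.1 hx with rfl | hx
        · simp only [heC, hθe, if_true, if_false]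
          group
        · have h1 : x ∈ C ↔ M.θ x ∈ C := hstep (.rel _ _ (Or.inr ⟨by simpa using hx, rfl⟩))
          by_cases hxC : x ∈ C
          · simp only [hxC, h1.1 hxC, if_true]
            rw [mul_assoc, hkL x hx]
          · simp only [hxC, mt h1.2 hxC, if_false]
            exact hkL x hx

theorem IsWalk.apply_eq [Finite M.Dart] {β : Type*} {p : M.Dart → β}
    (hσ : ∀ e, p (M.σ e) = p e) {a b : M.Vertex} {l : List M.Dart} (h : M.IsWalk a l b)
    (hp : ∀ d ∈ l, p (M.θ d) = p d) {f : M.Dart} (hf : M.src f = a) :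
    ∀ e, M.src e ∈ a :: l.map M.tgt → p e = p f := by
  induction l generalizing a f with
  | nil =>
    intro e he
    exact apply_eq_of_src_eq hσ ((List.mem_singleton.1 he).trans hf.symm)
  | cons d l ih =>
    intro e he
    rcases List.mem_cons.1 he with he | he
    · exact apply_eq_of_src_eq hσ (he.trans hf.symm)
    · rw [ih h.2 (fun d hd => hp d (List.mem_cons_of_mem _ hd)) (f := M.θ d) rfl e he,
        hp d List.mem_cons_self, apply_eq_of_src_eq hσ (h.1.trans hf.symm)]

/-- On a sphere, every voltage whose monodromy is trivial at all vertices off a simple path is gauge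
equivalent to one supported on this path. -/
theorem IsWalk.exists_gaugeEquiv_supportedOn [Finite M.Dart] (hconn : M.Connected)
    (htri : ∀ e, M.σ (M.θ (M.σ (M.θ (M.σ (M.θ e))))) = e) (hexact : ClosedFormsExact M)
    {a b : M.Vertex} {l : List M.Dart} (h : M.IsWalk a l b)
    {s : M.Dart → A} (hs : IsVoltage s)
    (hmono : ∀ e, M.src e ∉ a :: l.map M.tgt → monodromy s e = 1) :
    ∃ s' : M.Dart → A, IsVoltage s' ∧ GaugeEquiv s s' ∧ SupportedOn s' l := by
  classical
  have := Fintype.ofFinite M.Dart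
  set S₀ : Set M.Vertex := {w | w ∈ a :: l.map M.tgt}
  set R₀ : Set M.Dart := {e | e ∈ l ∨ M.θ e ∈ l} with hR₀
  have hR₀src : ∀ e ∈ R₀, M.src e ∈ S₀ := by
    rintro e (he | he)
    · change M.src e ∈ a :: l.map M.tgt
      rw [← h.map_src]
      exact List.mem_append_left _ (List.mem_map_of_mem he)
    · rw [← tgt_θ]
      exact List.mem_cons_of_mem _ (List.mem_map_of_mem he)
  have hR₀θ : ∀ e ∈ R₀, M.θ e ∈ R₀ := by
    rintro e (he | he)
    · exact Or.inr (by rwa [M.θ_invol])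
    · exact Or.inl he
  obtain ⟨R, hg⟩ := exists_grows_univ hconn ⟨a, List.mem_cons_self⟩ R₀ (S₀ := S₀)
  have hR₀R : R₀ ⊆ R := hg.base_subset
  obtain ⟨f, hf⟩ := Quotient.exists_rep a
  obtain ⟨k, hk, hkL⟩ := exists_gauge_eq_one htri hexact (hg.inv_mem hR₀θ)
    (fun p hp hpR e e' => by
      have := hg.apply_eq hp hpR (b := p f)
        (h.apply_eq hp (fun d hd => hpR d (hR₀R (Or.inl hd))) hf)
      rw [this e trivial, this e' trivial])
    hs (Finset.univ.filter (· ∉ R)) (by simp)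
  have hgauge : GaugeEquiv s (fun e => k (M.θ e) * s e * (k e)⁻¹) :=
    ⟨k, hk, fun e => by group⟩
  have hs' : IsVoltage (fun e => k (M.θ e) * s e * (k e)⁻¹) := fun e => by
    simp only [M.θ_invol, hs e]
    group
  refine ⟨_, hs', hgauge, fun e h1 h2 => ?_⟩
  refine hg.eq_one hR₀src hs' (fun e he => ?_) (fun e he => ?_) e (fun h3 => h3.elim h1 h2)
  · have := isConj_monodromy_of_gaugeEquiv hgauge e
    rw [hmono e he] at this
    exact isConj_one_right.1 this
  · rw [hkL e (by simpa using he), mul_inv_cancel]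

end PlaneGraph

namespace PlaneGraph

variable {M : PlaneGraph.{u}} {A : Type*} [Group A]

/-! ### Comparison of two cut paths -/

theorem IsWalk.mem_of_end {a b : M.Vertex} {l : List M.Dart} (h : M.IsWalk a l b) :
    b ∈ a :: l.map M.tgt := by
  cases l with
  | nil => exact List.mem_singleton.2 (Eq.symm h)
  | cons d l => exact List.mem_cons_of_mem _ h.end_mem

/-- The dart after `d` on a walk, unless `d` is the last one. -/
theorem IsWalk.exists_next {a b : M.Vertex} {l : List M.Dart} (h : M.IsWalk a l b) {d : M.Dart}
    (hd : d ∈ l) (hdb : M.tgt d ≠ b) : ∃ d' ∈ l, M.src d' = M.tgt d := by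
  obtain ⟨p, q, rfl⟩ := List.append_of_mem hd
  obtain ⟨c, -, h2⟩ := h.of_append
  cases q with
  | nil => exact absurd h2.2 hdb
  | cons d' q => exact ⟨d', by simp, h2.2.1⟩

namespace CutPath

variable {v₀ v₁ v₂ : M.Vertex} (P : CutPath M v₀ v₁ v₂)

theorem walk : M.IsWalk v₁ (P.l₁ ++ P.l₂) v₂ := P.walk₁.append P.walk₂

theorem nodup_tgt_append : (P.l₁.map M.tgt ++ P.l₂.map M.tgt).Nodup := by
  rw [← List.map_append]
  exact (List.nodup_cons.1 P.simple).2

theorem l₁_eq_nil_iff : P.l₁ = [] ↔ v₁ = v₀ := by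
  constructor
  · intro h
    have := P.walk₁
    rwa [h] at this
  · intro h
    cases hl : P.l₁ with
    | nil => rfl
    | cons d q =>
      have h1 := P.walk₁
      rw [hl] at h1
      have h2 := (List.nodup_cons.1 P.simple).1
      rw [List.map_append, List.mem_append, hl] at h2
      exact absurd (Or.inl (h.symm ▸ h1.end_mem)) h2

theorem l₂_eq_nil_iff : P.l₂ = [] ↔ v₀ = v₂ := by
  constructor
  · intro h
    have := P.walk₂
    rwa [h] at this
  · intro h
    cases hl : P.l₂ with
    | nil => rfl
    | cons d q =>
      have h1 := P.walk₂
      rw [hl] at h1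
      have h2 := P.simple
      rw [List.map_append, ← List.cons_append, List.nodup_append] at h2
      refine absurd h (h2.2.2 _ P.walk₁.mem_of_end _ ?_)
      rw [hl]
      exact h1.end_mem

theorem special_mem {w : M.Vertex} (hw : w = v₀ ∨ w = v₁ ∨ w = v₂) :
    w ∈ v₁ :: (P.l₁ ++ P.l₂).map M.tgt := by
  rcases hw with rfl | rfl | rfl
  · rw [List.map_append, ← List.cons_append]
    exact List.mem_append_left _ P.walk₁.mem_of_end
  · exact List.mem_cons_self
  · exact P.walk.mem_of_end

variable {P} {s : M.Dart → A}

theorem monodromy_eq_one [Finite M.Dart] (hs : IsVoltage s)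
    (hsupp : SupportedOn s (P.l₁ ++ P.l₂)) (h₁ : ∀ d ∈ P.l₁, ∀ d' ∈ P.l₁, s d = s d')
    (h₂ : ∀ d ∈ P.l₂, ∀ d' ∈ P.l₂, s d = s d') {e : M.Dart}
    (he : ¬ (M.src e = v₀ ∨ M.src e = v₁ ∨ M.src e = v₂)) : monodromy s e = 1 := by
  by_cases hmem : M.src e ∈ v₁ :: (P.l₁ ++ P.l₂).map M.tgt
  · rcases List.mem_cons.1 hmem with h | h
    · exact absurd (Or.inr (Or.inl h)) he
    obtain ⟨d, hd, hde⟩ := List.mem_map.1 h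
    obtain ⟨d', hd', hdd', heq⟩ : ∃ d' ∈ P.l₁ ++ P.l₂, M.src d' = M.tgt d ∧ s d' = s d := by
      rcases List.mem_append.1 hd with hd | hd
      · obtain ⟨d', hd', hdd'⟩ := P.walk₁.exists_next hd (by
          rw [hde]
          exact fun h => he (Or.inl h))
        exact ⟨d', List.mem_append_left _ hd', hdd', h₁ _ hd' _ hd⟩
      · obtain ⟨d', hd', hdd'⟩ := P.walk₂.exists_next hd (by
          rw [hde]
          exact fun h => he (Or.inr (Or.inr h)))
        exact ⟨d', List.mem_append_right _ hd', hdd', h₂ _ hd' _ hd⟩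
    have h3 := isConj_monodromy_of_src_eq s (show M.src (M.θ d) = M.src e from hde)
    rw [P.walk.monodromy_inner P.simple hs hsupp hd hd' hdd', heq, mul_inv_cancel] at h3
    exact isConj_one_right.1 h3
  · exact P.walk.monodromy_off hsupp hmem

theorem eq_of_consecutive [Finite M.Dart] (hs : IsVoltage s)
    (hsupp : SupportedOn s (P.l₁ ++ P.l₂))
    (hmono : ∀ e, ¬ (M.src e = v₀ ∨ M.src e = v₁ ∨ M.src e = v₂) → monodromy s e = 1)
    {d d' : M.Dart} (hd : d ∈ P.l₁ ++ P.l₂) (hd' : d' ∈ P.l₁ ++ P.l₂)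
    (hdd' : M.src d' = M.tgt d) (hd0 : M.tgt d ≠ v₀) : s d = s d' := by
  have h1 := hmono (M.θ d) (by
    rintro (h | h | h)
    · exact hd0 h
    · exact tgt_ne_start P.simple hd h
    · exact P.walk.src_ne_end P.simple hd' (hdd'.trans h))
  rw [P.walk.monodromy_inner P.simple hs hsupp hd hd' hdd', mul_inv_eq_one] at h1
  exact h1.symm

theorem eq_of_mem_l₁ [Finite M.Dart] (hs : IsVoltage s)
    (hsupp : SupportedOn s (P.l₁ ++ P.l₂))
    (hmono : ∀ e, ¬ (M.src e = v₀ ∨ M.src e = v₁ ∨ M.src e = v₂) → monodromy s e = 1) :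
    ∀ d ∈ P.l₁, ∀ d' ∈ P.l₁, s d = s d' := by
  cases hl : P.l₁ with
  | nil => simp
  | cons f l =>
    suffices h : ∀ d ∈ f :: l, s d = s f from fun d hd d' hd' => (h d hd).trans (h d' hd').symm
    refine List.eq_head_of_forall_consecutive fun p x y q hpq => ?_
    have hw := P.walk₁
    have hn := (List.nodup_append.1 P.nodup_tgt_append).1
    rw [hl, hpq] at hw hn
    obtain ⟨c, -, h2⟩ := hw.of_append
    refine eq_of_consecutive hs hsupp hmono ?_ ?_ h2.2.1 ?_
    · rw [hl, hpq]; simp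
    · rw [hl, hpq]; simp
    · rw [List.map_append, List.map_cons, List.nodup_append, List.nodup_cons] at hn
      exact fun h => hn.2.1.1 (h ▸ h2.2.end_mem)

theorem eq_of_mem_l₂ [Finite M.Dart] (hs : IsVoltage s)
    (hsupp : SupportedOn s (P.l₁ ++ P.l₂))
    (hmono : ∀ e, ¬ (M.src e = v₀ ∨ M.src e = v₁ ∨ M.src e = v₂) → monodromy s e = 1) :
    ∀ d ∈ P.l₂, ∀ d' ∈ P.l₂, s d = s d' := by
  cases hl : P.l₂ with
  | nil => simp
  | cons f l =>
    suffices h : ∀ d ∈ f :: l, s d = s f from fun d hd d' hd' => (h d hd).trans (h d' hd').symm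
    refine List.eq_head_of_forall_consecutive fun p x y q hpq => ?_
    have hw := P.walk₂
    have hn := P.simple
    rw [List.map_append, ← List.cons_append, List.nodup_append, hl, hpq] at hn
    rw [hl, hpq] at hw
    obtain ⟨c, -, h2⟩ := hw.of_append
    refine eq_of_consecutive hs hsupp hmono ?_ ?_ h2.2.1 ?_
    · rw [hl, hpq]; simp
    · rw [hl, hpq]; simp
    · exact fun h => hn.2.2 _ P.walk₁.mem_of_end (M.tgt x) (by simp) h.symm

theorem exists_monodromy_v₁ [Finite M.Dart] (hsupp : SupportedOn s (P.l₁ ++ P.l₂))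
    (hne : P.l₁ ≠ []) : ∃ d ∈ P.l₁, M.src d = v₁ ∧ monodromy s d = s d := by
  obtain ⟨d, q, hq⟩ := List.exists_cons_of_ne_nil hne
  have hw := P.walk₁
  rw [hq] at hw
  have hd : d ∈ P.l₁ := by simp [hq]
  exact ⟨d, hd, hw.1, P.walk.monodromy_start P.simple hsupp (List.mem_append_left _ hd) hw.1⟩

theorem exists_monodromy_v₂ [Finite M.Dart] (hs : IsVoltage s)
    (hsupp : SupportedOn s (P.l₁ ++ P.l₂)) (hne : P.l₂ ≠ []) :
    ∃ d ∈ P.l₂, M.src (M.θ d) = v₂ ∧ monodromy s (M.θ d) = (s d)⁻¹ := by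
  obtain ⟨d, q, hq⟩ := List.exists_cons_of_ne_nil hne
  have hw := P.walk₂
  rw [hq] at hw
  have h1 := hw.end_mem
  rw [← hq] at h1
  obtain ⟨d, hd, hd2⟩ := List.mem_map.1 h1
  exact ⟨d, hd, hd2, P.walk.monodromy_end P.simple hs hsupp (List.mem_append_right _ hd) hd2⟩

theorem exists_monodromy_v₀ [Finite M.Dart] (hs : IsVoltage s)
    (hsupp : SupportedOn s (P.l₁ ++ P.l₂)) (hne₁ : P.l₁ ≠ []) (hne₂ : P.l₂ ≠ []) :
    ∃ d ∈ P.l₁, ∃ d' ∈ P.l₂, M.src (M.θ d) = v₀ ∧ monodromy s (M.θ d) = s d' * (s d)⁻¹ := by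
  obtain ⟨d, q, hq⟩ := List.exists_cons_of_ne_nil hne₁
  have hw := P.walk₁
  rw [hq] at hw
  have h1 := hw.end_mem
  rw [← hq] at h1
  obtain ⟨d, hd, hd2⟩ := List.mem_map.1 h1
  obtain ⟨d', q', hq'⟩ := List.exists_cons_of_ne_nil hne₂
  have hw' := P.walk₂
  rw [hq'] at hw'
  have hd' : d' ∈ P.l₂ := by simp [hq']
  exact ⟨d, hd, d', hd', hd2, P.walk.monodromy_inner P.simple hs hsupp
    (List.mem_append_left _ hd) (List.mem_append_right _ hd') (hw'.1.trans hd2.symm)⟩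

variable (P)

open scoped Classical in
/-- The voltage with value `a` on the darts from `v₁` to `v₀`, `b` on the darts from `v₀` to `v₂`, the
inverse values on the inverse darts, and `1` elsewhere. The cases are distinguished in the same order
as in `CutPath.s`. -/
noncomputable def voltage (a b : A) (e : M.Dart) : A :=
  if e ∈ P.P₂ then b⁻¹
  else if e ∈ P.P₁ then a
  else if e ∈ P.P₂' then b
  else if e ∈ P.P₁' then a⁻¹
  else 1

theorem s_eq_voltage (G : PlaneGraph.{v}) (e : M.Dart) :
    P.s G e = P.voltage G.s₁⁻¹ G.s₂⁻¹ e := by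
  simp only [s, voltage, inv_inv]

theorem map_voltage {B : Type*} [Group B] (F : A →* B) (a b : A) (e : M.Dart) :
    F (P.voltage a b e) = P.voltage (F a) (F b) e := by
  simp only [voltage, apply_ite F, map_inv, map_one]

theorem disjoint_l₁_l₂ {d : M.Dart} (h₁ : d ∈ P.l₁) (h₂ : d ∈ P.l₂) : False :=
  (List.nodup_append.1 P.nodup_tgt_append).2.2 _ (List.mem_map_of_mem h₁) _
    (List.mem_map_of_mem h₂) rfl

theorem voltage_of_mem_l₁ (a b : A) {d : M.Dart} (hd : d ∈ P.l₁) : P.voltage a b d = a := by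
  have h := P.walk.inv_notMem P.simple d (List.mem_append_left _ hd)
  have h1 : d ∉ P.P₂ := fun h2 => h (List.mem_append_right _ h2)
  have h2 : d ∈ P.P₁ := hd
  simp [voltage, h1, h2]

theorem voltage_of_mem_l₂ (a b : A) {d : M.Dart} (hd : d ∈ P.l₂) : P.voltage a b d = b := by
  have h := P.walk.inv_notMem P.simple d (List.mem_append_right _ hd)
  have h1 : d ∉ P.P₂ := fun h2 => h (List.mem_append_right _ h2)
  have h2 : d ∉ P.P₁ := fun h2 => P.disjoint_l₁_l₂ h2 hd
  have h3 : d ∈ P.P₂' := hd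
  simp [voltage, h1, h2, h3]

theorem supportedOn_voltage (a b : A) : SupportedOn (P.voltage a b) (P.l₁ ++ P.l₂) := by
  intro e h1 h2
  rw [List.mem_append, not_or] at h1 h2
  have h3 : e ∉ P.P₁ := h1.1
  have h4 : e ∉ P.P₂' := h1.2
  have h5 : e ∉ P.P₁' := h2.1
  have h6 : e ∉ P.P₂ := h2.2
  simp [voltage, h3, h4, h5, h6]

theorem isVoltage_voltage (a b : A) : IsVoltage (P.voltage a b) := by
  have key : ∀ d ∈ P.l₁ ++ P.l₂, P.voltage a b (M.θ d) = (P.voltage a b d)⁻¹ := by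
    intro d hd
    have h := P.walk.inv_notMem P.simple d hd
    rw [List.mem_append, not_or] at h
    have h1 : M.θ d ∉ P.P₁ := h.1
    have h2 : M.θ d ∉ P.P₂' := h.2
    by_cases h3 : d ∈ P.l₂
    · have h4 : M.θ d ∈ P.P₂ := by simpa [P₂, M.θ_invol] using h3
      rw [P.voltage_of_mem_l₂ a b h3]
      simp [voltage, h4]
    · have h4 : M.θ d ∉ P.P₂ := by simpa [P₂, M.θ_invol] using h3
      have h5 : d ∈ P.l₁ := (List.mem_append.1 hd).resolve_right h3
      have h6 : M.θ d ∈ P.P₁' := by simpa [P₁', M.θ_invol] using h5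
      rw [P.voltage_of_mem_l₁ a b h5]
      simp [voltage, h1, h2, h4, h6]
  intro e
  by_cases h1 : e ∈ P.l₁ ++ P.l₂
  · exact key e h1
  by_cases h2 : M.θ e ∈ P.l₁ ++ P.l₂
  · have := key _ h2
    rw [M.θ_invol] at this
    rw [this, inv_inv]
  · rw [P.supportedOn_voltage a b e h1 h2, P.supportedOn_voltage a b _ h2 (by rwa [M.θ_invol]),
      inv_one]

theorem voltage_gaugeEquiv (hs : IsVoltage s) (hsupp : SupportedOn s (P.l₁ ++ P.l₂)) {a b g : A}
    (h₁ : ∀ d ∈ P.l₁, s d = g * a * g⁻¹) (h₂ : ∀ d ∈ P.l₂, s d = g * b * g⁻¹) :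
    GaugeEquiv (P.voltage a b) s := by
  refine ⟨fun _ => g, fun _ => rfl, fun e => ?_⟩
  suffices h : s e = g * P.voltage a b e * g⁻¹ by rw [h]; group
  have key : ∀ d ∈ P.l₁ ++ P.l₂, s d = g * P.voltage a b d * g⁻¹ := by
    intro d hd
    rcases List.mem_append.1 hd with hd | hd
    · rw [h₁ d hd, P.voltage_of_mem_l₁ a b hd]
    · rw [h₂ d hd, P.voltage_of_mem_l₂ a b hd]
  by_cases h1 : e ∈ P.l₁ ++ P.l₂
  · exact key e h1
  by_cases h2 : M.θ e ∈ P.l₁ ++ P.l₂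
  · have := key _ h2
    rw [hs, P.isVoltage_voltage] at this
    rw [← inv_inv (s e), this]
    group
  · rw [hsupp e h1 h2, P.supportedOn_voltage a b e h1 h2]
    group

variable {P}

/-- A voltage supported on `P` that is gauge equivalent to the standard voltage of `Q` in the free
group is gauge equivalent to the standard voltage of `P`: its monodromies at `v₁`, `v₂` and `v₀` are
conjugate to `α⁻¹`, `β⁻¹` and `βα`, and this determines its values up to a common conjugation. -/
theorem voltage_gaugeEquiv_of_gaugeEquiv [Finite M.Dart] (Q : CutPath M v₀ v₁ v₂)
    {s : M.Dart → FreeGroup Bool} (hs : IsVoltage s) (hsupp : SupportedOn s (P.l₁ ++ P.l₂))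
    (hQ : GaugeEquiv (Q.voltage (FreeGroup.of false)⁻¹ (FreeGroup.of true)) s) :
    GaugeEquiv (P.voltage (FreeGroup.of false)⁻¹ (FreeGroup.of true)) s := by
  set α := FreeGroup.of false
  set β := FreeGroup.of true
  have hQv := Q.isVoltage_voltage α⁻¹ β
  have hQs := Q.supportedOn_voltage α⁻¹ β
  have hconj : ∀ {e f : M.Dart}, M.src e = M.src f →
      IsConj (monodromy (Q.voltage α⁻¹ β) e) (monodromy s f) := fun h =>
    (isConj_monodromy_of_src_eq _ h).trans (isConj_monodromy_of_gaugeEquiv hQ _)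
  have hmono : ∀ e, ¬ (M.src e = v₀ ∨ M.src e = v₁ ∨ M.src e = v₂) → monodromy s e = 1 := by
    intro e he
    have h := hconj (rfl : M.src e = M.src e)
    rw [monodromy_eq_one hQv hQs
      (fun d hd d' hd' => by rw [Q.voltage_of_mem_l₁ _ _ hd, Q.voltage_of_mem_l₁ _ _ hd'])
      (fun d hd d' hd' => by rw [Q.voltage_of_mem_l₂ _ _ hd, Q.voltage_of_mem_l₂ _ _ hd']) he] at h
    exact isConj_one_right.1 h
  have hconst₁ := eq_of_mem_l₁ hs hsupp hmono
  have hconst₂ := eq_of_mem_l₂ hs hsupp hmono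
  have hg : P.l₁ ≠ [] → ∃ g, ∀ d ∈ P.l₁, s d = (g * α * g⁻¹)⁻¹ := by
    intro hne
    obtain ⟨d, hd, hd1, hdm⟩ := exists_monodromy_v₁ hsupp hne
    obtain ⟨d', hd', hd1', hdm'⟩ := exists_monodromy_v₁ hQs
      (fun h => hne (P.l₁_eq_nil_iff.2 (Q.l₁_eq_nil_iff.1 h)))
    have h := hconj (hd1'.trans hd1.symm)
    rw [hdm, hdm', Q.voltage_of_mem_l₁ _ _ hd'] at h
    obtain ⟨g, hg⟩ := isConj_iff.1 h
    refine ⟨g, fun x hx => ?_⟩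
    rw [hconst₁ x hx d hd, ← hg]
    group
  have hh : P.l₂ ≠ [] → ∃ h, ∀ d ∈ P.l₂, s d = h * β * h⁻¹ := by
    intro hne
    obtain ⟨d, hd, hd1, hdm⟩ := exists_monodromy_v₂ hs hsupp hne
    obtain ⟨d', hd', hd1', hdm'⟩ := exists_monodromy_v₂ hQv hQs
      (fun h => hne (P.l₂_eq_nil_iff.2 (Q.l₂_eq_nil_iff.1 h)))
    have h := hconj (hd1'.trans hd1.symm)
    rw [hdm, hdm', Q.voltage_of_mem_l₂ _ _ hd'] at h
    obtain ⟨g, hg⟩ := isConj_iff.1 h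
    refine ⟨g, fun x hx => ?_⟩
    rw [hconst₂ x hx d hd, ← inv_inv (s d), ← hg]
    group
  -- A part of the path is empty exactly if its end vertices coincide, which is then so for `Q` too.
  by_cases hne₁ : P.l₁ = []
  · by_cases hne₂ : P.l₂ = []
    · exact P.voltage_gaugeEquiv hs hsupp (g := 1) (by simp [hne₁]) (by simp [hne₂])
    · obtain ⟨h, hh⟩ := hh hne₂
      exact P.voltage_gaugeEquiv hs hsupp (g := h) (by simp [hne₁]) hh
  obtain ⟨g, hg⟩ := hg hne₁
  by_cases hne₂ : P.l₂ = []
  · refine P.voltage_gaugeEquiv hs hsupp (g := g) (fun d hd => ?_) (by simp [hne₂])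
    rw [hg d hd]
    group
  obtain ⟨h, hh⟩ := hh hne₂
  obtain ⟨d, hd, d', hd', hd0, hdm⟩ := exists_monodromy_v₀ hs hsupp hne₁ hne₂
  obtain ⟨f, hf, f', hf', hf0, hfm⟩ := exists_monodromy_v₀ hQv hQs
    (fun h => hne₁ (P.l₁_eq_nil_iff.2 (Q.l₁_eq_nil_iff.1 h)))
    (fun h => hne₂ (P.l₂_eq_nil_iff.2 (Q.l₂_eq_nil_iff.1 h)))
  have hc := hconj (hf0.trans hd0.symm)
  rw [hdm, hfm, Q.voltage_of_mem_l₁ _ _ hf, Q.voltage_of_mem_l₂ _ _ hf', hg d hd, hh d' hd',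
    inv_inv, inv_inv] at hc
  obtain ⟨k, hk₁, hk₂⟩ := FreeGroup.exists_simultaneous_conj hc.symm
  refine P.voltage_gaugeEquiv hs hsupp (g := k) (fun x hx => ?_) (fun x hx => ?_)
  · rw [hg x hx, hk₁]
    change (k * α * k⁻¹)⁻¹ = _
    group
  · rw [hh x hx, hk₂]

/-- On a finite triangulated sphere, the voltages of any two cut paths are gauge equivalent. -/
theorem s_gaugeEquiv [Finite M.Dart] (hconn : M.Connected)
    (htri : ∀ e, M.σ (M.θ (M.σ (M.θ (M.σ (M.θ e))))) = e) (hexact : ClosedFormsExact M)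
    (P Q : CutPath M v₀ v₁ v₂) (G : PlaneGraph.{v}) : GaugeEquiv (P.s G) (Q.s G) := by
  obtain ⟨s, hs, hQs, hsupp⟩ := P.walk.exists_gaugeEquiv_supportedOn hconn htri hexact
    (Q.isVoltage_voltage (FreeGroup.of false)⁻¹ (FreeGroup.of true)) (fun e he =>
      monodromy_eq_one (Q.isVoltage_voltage _ _) (Q.supportedOn_voltage _ _)
        (fun d hd d' hd' => by rw [Q.voltage_of_mem_l₁ _ _ hd, Q.voltage_of_mem_l₁ _ _ hd'])
        (fun d hd d' hd' => by rw [Q.voltage_of_mem_l₂ _ _ hd, Q.voltage_of_mem_l₂ _ _ hd'])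
        (fun h => he (P.special_mem h)))
  have h := ((voltage_gaugeEquiv_of_gaugeEquiv Q hs hsupp hQs).trans hQs.symm).map
    (FreeGroup.lift fun b => bif b then G.s₂⁻¹ else G.s₁)
  simp only [map_voltage, map_inv, FreeGroup.lift_apply_of, cond_true, cond_false] at h
  rwa [← funext (P.s_eq_voltage G), ← funext (Q.s_eq_voltage G)] at h

end CutPath

/-- A gauge equivalence between the voltages of two cut paths is an isomorphism of the applications
that fixes the first component of all darts. -/
theorem exists_iso_of_gaugeEquiv {v₀ v₁ v₂ : M.Vertex} {P Q : CutPath M v₀ v₁ v₂}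
    {G : PlaneGraph.{v}} (h : GaugeEquiv (P.s G) (Q.s G)) :
    ∃ f : Iso (application P G) (application Q G),
      ∀ x : M.Dart × G.DoubleChamber, (f.toFun x).1 = x.1 := by
  obtain ⟨k, h1, h2⟩ := h
  refine ⟨⟨Equiv.prodShear (Equiv.refl _) k, ?_, ?_⟩, fun x => rfl⟩
  · rintro ⟨e, c⟩
    refine Prod.ext rfl ?_
    change k (M.σ e) (P.s G e c) = Q.s G e (k e c)
    rw [h1, ← Equiv.Perm.mul_apply, h2, Equiv.Perm.mul_apply]
  · rintro ⟨e, c⟩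
    refine Prod.ext rfl ?_
    change k (M.θ e) (P.s G e c) = Q.s G e (k e c)
    rw [← Equiv.Perm.mul_apply, h2, Equiv.Perm.mul_apply]

end PlaneGraph

/-! ### Closed forms on a tiling of the plane -/

/-- A continuous real function on a connected space that takes only integer values is constant. -/
theorem eq_of_forall_coe_addCircle_eq_zero {X : Type*} [TopologicalSpace X] [PreconnectedSpace X]
    {f : X → ℝ} (hf : Continuous f) (h : ∀ x, (f x : AddCircle (1 : ℝ)) = 0) (x y : X) :
    f x = f y := by
  choose n hn using fun x => AddCircle.coe_eq_zero_iff (1 : ℝ) |>.1 (h x)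
  have hfn : f = fun x => (n x : ℝ) := funext fun x => by simp [← hn x]
  have hc : Continuous n := by
    rw [Int.isClosedEmbedding_coe_real.isInducing.continuous_iff]
    rwa [hfn] at hf
  rw [← hn x, ← hn y, PreconnectedSpace.constant ‹_› hc]

namespace PlaneGraph

/-- The integral of a `1`-form on the chamber system from the corner of type `0` of a chamber to its
corner of type `j`, along a side of the chamber. -/
def cornerValue (M : PlaneGraph.{u}) (ψ : M.chamberSystem.Dart → ℤ) : M.Chamber → Fin 3 → ℤ
  | _, 0 => 0
  | (e, _), 1 => ψ (.ve e)
  | (e, true), 2 => ψ (.vf e)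
  | (e, false), 2 => ψ (.vf (M.σ e))

/-- For a closed form, the integrals along the common side of two adjacent chambers agree. -/
theorem cornerValue_adjChamber (M : PlaneGraph.{u}) {ψ : M.chamberSystem.Dart → ℤ}
    (hψ : ∀ d, ψ (M.chamberSystem.θ d) = -ψ d)
    (hcl : ∀ d, ψ d + ψ (M.chamberSystem.σ (M.chamberSystem.θ d)) +
      ψ (M.chamberSystem.σ (M.chamberSystem.θ (M.chamberSystem.σ (M.chamberSystem.θ d)))) = 0)
    (c : M.Chamber) {i j k : Fin 3} (hj : j ≠ i) (hk : k ≠ i) :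
    M.cornerValue ψ c j - M.cornerValue ψ c k
      = M.cornerValue ψ (M.adjChamber i c) j - M.cornerValue ψ (M.adjChamber i c) k := by
  have h1 : ∀ e, ψ (.ve e) + ψ (.ef e) + ψ (.fv e) = 0 := fun e => hcl (.ve e)
  have h2 : ∀ e, ψ (.ev e) + ψ (.vf (M.σ e)) + ψ (.fe ((M.σ * M.θ)⁻¹ (M.σ e))) = 0 :=
    fun e => hcl (.ev e)
  have h3 : ∀ e, ψ (.ev e) = -ψ (.ve e) := fun e => hψ (.ve e)
  have h4 : ∀ e, ψ (.fv e) = -ψ (.vf e) := fun e => hψ (.vf e)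
  have h5 : ∀ e, ψ (.fe e) = -ψ (.ef e) := fun e => hψ (.ef e)
  have h6 : ∀ e, (M.σ * M.θ)⁻¹ (M.σ e) = M.θ e := fun e => by
    rw [Equiv.Perm.inv_eq_iff_eq, Equiv.Perm.mul_apply, M.θ_invol]
  have key : ∀ e, ψ (.ve e) - ψ (.vf e) = ψ (.ve (M.θ e)) - ψ (.vf (M.σ (M.θ e))) := by
    intro e
    have h7 := h2 (M.θ e)
    rw [h6, M.θ_invol] at h7
    linarith [h1 e, h3 (M.θ e), h4 e, h5 e]
  obtain ⟨e, b⟩ := c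
  have key' : ψ (.ve e) - ψ (.vf (M.σ e)) = ψ (.ve (M.θ e)) - ψ (.vf (M.θ e)) := by
    have h8 := key (M.θ e)
    rw [M.θ_invol] at h8
    exact h8.symm
  have key := key e
  clear h1 h2 h3 h4 h5 h6 hψ hcl
  fin_cases i <;> fin_cases j <;> fin_cases k <;> cases b <;>
    simp [cornerValue, adjChamber] at hj hk ⊢ <;> linarith

end PlaneGraph

namespace Tiling

variable (T : Tiling.{u})

theorem point_adjChamber {i : Fin 3} {x : stdSimplex ℝ (Fin 3)} (hx : x.1 i = 0)
    (c : T.graph.Chamber) : T.point (T.graph.adjChamber i c) x = T.point c x :=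
  ((T.point_eq_iff _ _ _ _).2 ⟨rfl, .rel _ _ ⟨i, hx, rfl⟩⟩).symm

theorem vertex_apply_of_ne {i j : Fin 3} (h : j ≠ i) :
    (stdSimplex.vertex (S := ℝ) j).1 i = 0 :=
  Pi.single_eq_of_ne h.symm _

theorem srcPoint_σ (d : T.graph.chamberSystem.Dart) :
    T.srcPoint (T.graph.chamberSystem.σ d) = T.srcPoint d := by
  have adj : ∀ {j : Fin 3} (i : Fin 3) (_ : j ≠ i) (c : T.graph.Chamber),
      T.point (T.graph.adjChamber i c) (stdSimplex.vertex j) = T.point c (stdSimplex.vertex j) :=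
    fun i h c => T.point_adjChamber (vertex_apply_of_ne h) c
  have h1 : ∀ e, T.point (T.graph.σ e, true) (stdSimplex.vertex 0)
      = T.point (e, true) (stdSimplex.vertex 0) := fun e =>
    (adj 1 (by decide) (e, false)).trans (adj 2 (by decide) (e, true))
  have h2 : ∀ e, T.point (T.graph.θ e, true) (stdSimplex.vertex 1)
      = T.point (e, true) (stdSimplex.vertex 1) := fun e =>
    (adj 0 (by decide) (e, false)).trans (adj 2 (by decide) (e, true))
  have h3 : ∀ e, T.point (T.graph.σ (T.graph.θ e), true) (stdSimplex.vertex 2)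
      = T.point (e, true) (stdSimplex.vertex 2) := fun e =>
    (adj 1 (by decide) (T.graph.θ e, false)).trans (adj 0 (by decide) (e, true))
  cases d with
  | vf e => rfl
  | ve e => exact h1 e
  | ev e => rfl
  | ef e => exact h2 e
  | fe e => rfl
  | fv e =>
    obtain ⟨f, rfl⟩ := (T.graph.σ * T.graph.θ).surjective e
    change T.point ((T.graph.σ * T.graph.θ)⁻¹ ((T.graph.σ * T.graph.θ) f), true) _ = _
    rw [show (T.graph.σ * T.graph.θ)⁻¹ ((T.graph.σ * T.graph.θ) f) = f from
      Equiv.symm_apply_apply _ _]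
    exact (h3 f).symm

/-- The affine interpolation on a chamber of the values `p c j` at its corners. -/
def interpolation (p : T.graph.Chamber → Fin 3 → ℤ) (c : T.graph.Chamber)
    (x : stdSimplex ℝ (Fin 3)) : ℝ := ∑ j, x.1 j * p c j

theorem continuous_interpolation (p : T.graph.Chamber → Fin 3 → ℤ) (c : T.graph.Chamber) :
    Continuous (T.interpolation p c) := by
  unfold interpolation
  refine continuous_finsetSum _ fun j _ => ?_
  exact ((continuous_apply j).comp continuous_subtype_val).mul continuous_const

theorem interpolation_vertex (p : T.graph.Chamber → Fin 3 → ℤ) (c : T.graph.Chamber) (j : Fin 3) :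
    T.interpolation p c (stdSimplex.vertex j) = p c j := by
  simp [interpolation, Pi.single_apply]

variable {T} {p : T.graph.Chamber → Fin 3 → ℤ}

theorem interpolation_eq_of_sharePoint
    (hp : ∀ c i j k, j ≠ i → k ≠ i →
      p c j - p c k = p (T.graph.adjChamber i c) j - p (T.graph.adjChamber i c) k)
    {x : stdSimplex ℝ (Fin 3)} {c c' : T.graph.Chamber} (h : T.graph.SharePoint x c c') :
    (T.interpolation p c x : AddCircle (1 : ℝ)) = T.interpolation p c' x := by
  induction h with
  | refl c => rfl
  | symm c c' _ ih => exact ih.symm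
  | trans c c' c'' _ _ ih ih' => exact ih.trans ih'
  | rel c c' h =>
    obtain ⟨i, hi, rfl⟩ := h
    rw [← sub_eq_zero, ← AddCircle.coe_sub, AddCircle.coe_eq_zero_iff]
    refine ⟨p c (i + 1) - p (T.graph.adjChamber i c) (i + 1), ?_⟩
    have hne : i + 1 ≠ i := (by decide : ∀ i : Fin 3, i + 1 ≠ i) i
    set m := p c (i + 1) - p (T.graph.adjChamber i c) (i + 1) with hm
    have h1 : ∀ j, x.1 j * p c j - x.1 j * p (T.graph.adjChamber i c) j = x.1 j * m := by
      intro j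
      by_cases hj : j = i
      · rw [hj, hi]
        ring
      · have h2 : p c j - p (T.graph.adjChamber i c) j = m := by
          linarith [hp c i j (i + 1) hj hne]
        rw [← h2]
        push_cast
        ring
    rw [interpolation, interpolation, ← Finset.sum_sub_distrib, Finset.sum_congr rfl fun j _ => h1 j,
      ← Finset.sum_mul, x.2.2]
    simp

/-- A closed form on a tiling of the plane has a primitive. The primitive, modulo `1`, is a
continuous function on the plane; as the plane is simply connected, it lifts to a real function. -/
theorem exists_lift_interpolation
    (hp : ∀ c i j k, j ≠ i → k ≠ i →
      p c j - p c k = p (T.graph.adjChamber i c) j - p (T.graph.adjChamber i c) k) :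
    ∃ U : ℂ → ℝ, Continuous U ∧
      ∀ c x, (U (T.point c x) : AddCircle (1 : ℝ)) = T.interpolation p c x := by
  -- `w` is the primitive modulo `1`.
  choose c x hcx using T.covers
  set w : ℂ → AddCircle (1 : ℝ) := fun z => T.interpolation p (c z) (x z)
  have hw : ∀ c x, w (T.point c x) = T.interpolation p c x := by
    intro c' x'
    obtain ⟨h1, h2⟩ := (T.point_eq_iff _ _ _ _).1 (hcx (T.point c' x'))
    change ((T.interpolation p _ _ : ℝ) : AddCircle (1 : ℝ)) = _
    rw [h1] at h2 ⊢
    exact interpolation_eq_of_sharePoint hp h2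
  have hwc : Continuous w := by
    refine T.locallyFinite.continuous ?_ (fun c => (isCompact_range (T.continuous_point c)).isClosed)
      fun c => ?_
    · exact Set.eq_univ_of_forall fun z => Set.mem_iUnion.2 ⟨c z, x z, hcx z⟩
    · rw [continuousOn_iff_isClosed]
      intro t ht
      refine ⟨T.point c '' {x | ((T.interpolation p c x : ℝ) : AddCircle (1 : ℝ)) ∈ t}, ?_, ?_⟩
      · have hcont : Continuous fun x => ((T.interpolation p c x : ℝ) : AddCircle (1 : ℝ)) :=
          (AddCircle.continuous_mk' _).comp (T.continuous_interpolation p c)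
        exact ((ht.preimage hcont).isCompact.image (T.continuous_point c)).isClosed
      · ext z
        constructor
        · rintro ⟨h1, y, rfl⟩
          exact ⟨⟨y, by rwa [Set.mem_preimage, hw] at h1, rfl⟩, y, rfl⟩
        · rintro ⟨⟨y, hy, rfl⟩, -⟩
          exact ⟨by rwa [Set.mem_preimage, hw], y, rfl⟩
  obtain ⟨r, hr⟩ := QuotientAddGroup.mk_surjective (w 0)
  obtain ⟨U, ⟨-, hU⟩, -⟩ := (AddCircle.isCoveringMap_coe (1 : ℝ)).existsUnique_continuousMap_lifts
    ⟨w, hwc⟩ 0 r hr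
  exact ⟨U, U.continuous, fun c x => (congrFun hU _).trans (hw c x)⟩

theorem lift_interpolation_sub {U : ℂ → ℝ} (hU : Continuous U)
    (hUp : ∀ c x, (U (T.point c x) : AddCircle (1 : ℝ)) = T.interpolation p c x)
    (c : T.graph.Chamber) (j k : Fin 3) :
    U (T.point c (stdSimplex.vertex k)) - U (T.point c (stdSimplex.vertex j))
      = p c k - p c j := by
  have := eq_of_forall_coe_addCircle_eq_zero
    (f := fun x => U (T.point c x) - T.interpolation p c x)
    ((hU.comp (T.continuous_point c)).sub (T.continuous_interpolation p c))
    (fun x => by rw [AddCircle.coe_sub, hUp, sub_self]) (stdSimplex.vertex j) (stdSimplex.vertex k)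
  simp only [interpolation_vertex] at this
  linarith

/-- The primitive is invariant under the symmetries of the form that have a fixed point. -/
theorem lift_interpolation_invariant {U : ℂ → ℝ} (hU : Continuous U)
    (hUp : ∀ c x, (U (T.point c x) : AddCircle (1 : ℝ)) = T.interpolation p c x)
    {ρ : ℂ → ℂ} (hρ : Continuous ρ) {φ : T.graph.Iso T.graph} (h : T.Induces ρ φ)
    (hφ : ∀ e b j, p (φ.toEquiv e, b) j = p (e, b) j) {z₀ : ℂ} (hz₀ : ρ z₀ = z₀) (z : ℂ) :
    U (ρ z) = U z := by
  have := eq_of_forall_coe_addCircle_eq_zero (f := fun z => U (ρ z) - U z)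
    ((hU.comp hρ).sub hU) (fun z => by
      obtain ⟨⟨e, b⟩, x, rfl⟩ := T.covers z
      rw [AddCircle.coe_sub, ← h, hUp, hUp, interpolation, interpolation, sub_eq_zero]
      simp only [hφ]) z z₀
  simp only [hz₀, sub_self] at this
  linarith

/-- A function of the darts of the chamber system that is constant around the vertices depends only
on the point of the plane at which the dart starts. -/
theorem apply_eq_of_srcPoint_eq {β : Type*} {F : T.graph.chamberSystem.Dart → β}
    (hF : ∀ d, F (T.graph.chamberSystem.σ d) = F d) {d d' : T.graph.chamberSystem.Dart}
    (h : T.srcPoint d = T.srcPoint d') : F d = F d' := by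
  let corner : T.graph.Chamber → Fin 3 → β := fun c j => match c, j with
    | (e, _), 0 => F (.ve e)
    | (e, _), 1 => F (.ev e)
    | (e, true), 2 => F (.fv e)
    | (e, false), 2 => F (.fv (T.graph.σ e))
  have h1 : ∀ e, F (.ve e) = F (.vf e) := fun e => hF (.vf e)
  have h2 : ∀ e, F (.vf (T.graph.σ e)) = F (.ve e) := fun e => hF (.ve e)
  have h3 : ∀ e, F (.ef e) = F (.ev e) := fun e => hF (.ev e)
  have h4 : ∀ e, F (.ev (T.graph.θ e)) = F (.ef e) := fun e => hF (.ef e)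
  have h5 : ∀ e, F (.fv e) = F (.fe e) := fun e => hF (.fe e)
  have h6 : ∀ e, F (.fv (T.graph.σ (T.graph.θ e))) = F (.fv e) := fun e => by
    rw [← hF (.fv (T.graph.σ (T.graph.θ e))), h5 e]
    change F (.fe ((T.graph.σ * T.graph.θ)⁻¹ ((T.graph.σ * T.graph.θ) e))) = _
    rw [show (T.graph.σ * T.graph.θ)⁻¹ ((T.graph.σ * T.graph.θ) e) = e from
      Equiv.symm_apply_apply _ _]
  have hinv : ∀ e, T.graph.σ (T.graph.σ⁻¹ e) = e := fun e => Equiv.apply_symm_apply _ _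
  have hadj : ∀ (i j : Fin 3), j ≠ i → ∀ c, corner (T.graph.adjChamber i c) j = corner c j := by
    rintro i j hij ⟨e, b⟩
    fin_cases i <;> fin_cases j <;> cases b <;>
      first
      | exact absurd rfl hij
      | rfl
      | skip
    · exact (h4 e).trans (h3 e)
    · exact (h4 e).trans (h3 e)
    · change F (.fv (T.graph.θ e)) = F (.fv (T.graph.σ e))
      rw [← h6 (T.graph.θ e), T.graph.θ_invol]
    · exact h6 e
    · change F (.ve (T.graph.σ e)) = F (.ve e)
      rw [h1, h2]
    · change F (.ve (T.graph.σ⁻¹ e)) = F (.ve e)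
      rw [← h2, h1 e, hinv]
    · change F (.fv (T.graph.σ (T.graph.σ⁻¹ e))) = F (.fv e)
      rw [hinv]
  have hcorner : ∀ d : T.graph.chamberSystem.Dart,
      F d = corner (PlaneGraph.ChamberDart.base d, true) (PlaneGraph.ChamberDart.srcType d) := by
    intro d
    cases d with
    | ve e => rfl
    | ev e => rfl
    | fv e => rfl
    | vf e => exact (h1 e).symm
    | ef e => exact h3 e
    | fe e => exact (h5 e).symm
  obtain ⟨ht, hs⟩ := (T.point_eq_iff _ _ _ _).1 h
  have ht := stdSimplex.vertex_injective ht
  rw [hcorner d, hcorner d', ← ht]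
  generalize PlaneGraph.ChamberDart.srcType d = j at hs
  generalize (PlaneGraph.ChamberDart.base d, true) = c at hs ⊢
  generalize (PlaneGraph.ChamberDart.base d', true) = c' at hs ⊢
  induction hs with
  | refl => rfl
  | symm _ _ _ ih => exact ih.symm
  | trans _ _ _ _ _ ih ih' => exact ih.trans ih'
  | rel c c' h =>
    obtain ⟨i, hi, rfl⟩ := h
    refine (hadj i j ?_ c).symm
    rintro rfl
    simp at hi

end Tiling

/-! ### The decoration of an operation -/

namespace PlaneGraph

/-- Two darts lie in the same orbit of the group generated by `σ` and `θ`. -/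
def Reachable (M : PlaneGraph.{u}) (e f : M.Dart) : Prop :=
  ∃ g ∈ Subgroup.closure ({M.σ, M.θ} : Set (Equiv.Perm M.Dart)), g e = f

namespace Reachable

variable {M : PlaneGraph.{u}} {d e f : M.Dart}

theorem refl (e : M.Dart) : M.Reachable e e := ⟨1, one_mem _, rfl⟩

theorem symm (h : M.Reachable e f) : M.Reachable f e := by
  obtain ⟨g, hg, rfl⟩ := h
  exact ⟨g⁻¹, inv_mem hg, Equiv.symm_apply_apply g e⟩

theorem trans (h : M.Reachable d e) (h' : M.Reachable e f) : M.Reachable d f := by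
  obtain ⟨g, hg, rfl⟩ := h
  obtain ⟨g', hg', rfl⟩ := h'
  exact ⟨g' * g, mul_mem hg' hg, rfl⟩

theorem σ (e : M.Dart) : M.Reachable e (M.σ e) :=
  ⟨M.σ, Subgroup.subset_closure (Or.inl rfl), rfl⟩

theorem θ (e : M.Dart) : M.Reachable e (M.θ e) :=
  ⟨M.θ, Subgroup.subset_closure (Or.inr rfl), rfl⟩

/-- Reachability is preserved by relations that contain the images of single steps. -/
theorem induction {r : M.Dart → M.Dart → Prop} (refl : ∀ e, r e e)
    (symm : ∀ e f, r e f → r f e) (trans : ∀ d e f, r d e → r e f → r d f)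
    (hσ : ∀ e, r e (M.σ e)) (hθ : ∀ e, r e (M.θ e)) (h : M.Reachable e f) : r e f := by
  obtain ⟨g, hg, rfl⟩ := h
  induction hg using Subgroup.closure_induction generalizing e with
  | mem x hx =>
    rcases hx with rfl | rfl
    · exact hσ e
    · exact hθ e
  | one => exact refl e
  | mul x y _ _ hx hy => exact trans _ _ _ hy hx
  | inv x _ hx =>
    have h := hx (e := x⁻¹ e)
    rw [show x (x⁻¹ e) = e from Equiv.apply_symm_apply x e] at h
    exact symm _ _ h

end Reachable

theorem Connected.chamberSystem {M : PlaneGraph.{u}} (h : M.Connected) :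
    M.chamberSystem.Connected := by
  set C := M.chamberSystem
  have ev : ∀ e, C.Reachable (.ve e) (.ev e) := fun e => .θ _
  have vf : ∀ e, C.Reachable (.vf e) (.ve e) := fun e => .σ (M := C) (.vf e)
  have vf' : ∀ e, C.Reachable (.ve e) (.vf (M.σ e)) := fun e => .σ (M := C) (.ve e)
  have ef : ∀ e, C.Reachable (.ev e) (.ef e) := fun e => .σ (M := C) (.ev e)
  have ef' : ∀ e, C.Reachable (.ef e) (.ev (M.θ e)) := fun e => .σ (M := C) (.ef e)
  have fe : ∀ e, C.Reachable (.ef e) (.fe e) := fun e => .θ _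
  have fv : ∀ e, C.Reachable (.vf e) (.fv e) := fun e => .θ _
  have base : ∀ d : C.Dart, C.Reachable d (.ve (ChamberDart.base d)) := by
    intro d
    cases d with
    | ve e => exact .refl _
    | ev e => exact (ev e).symm
    | vf e => exact vf e
    | fv e => exact (fv e).symm.trans (vf e)
    | ef e => exact (ef e).symm.trans (ev e).symm
    | fe e => exact ((fe e).symm.trans (ef e).symm).trans (ev e).symm
  intro d d'
  refine ((base d).trans ?_).trans (base d').symm
  exact Reachable.induction (r := fun e f => C.Reachable (.ve e) (.ve f)) (fun _ => .refl _)
    (fun _ _ h => h.symm) (fun _ _ _ h h' => h.trans h') (fun e => (vf' e).trans (vf _))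
    (fun e => (((ev e).trans (ef e)).trans (ef' e)).trans (ev _).symm) (h _ _)

theorem ChamberDart.finite_base_mem {E : Type u} {F : Set E} (hF : F.Finite) :
    {d : ChamberDart E | d.base ∈ F}.Finite := by
  have hinj : Function.Injective fun d : ChamberDart E => (d.base, d.srcType, d.edgeType) := by
    intro d d' h
    cases d <;> cases d' <;> simp_all [base, srcType, edgeType]
  refine ((hF.prod (Set.toFinite (Set.univ : Set (Fin 3 × Fin 3)))).preimage hinj.injOn).subset ?_
  exact fun d hd => ⟨hd, trivial⟩

end PlaneGraph

theorem continuous_clockwiseRotation (c : ℂ) (α : ℝ) : Continuous (clockwiseRotation c α) := by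
  unfold clockwiseRotation
  fun_prop

theorem clockwiseRotation_center (c : ℂ) (α : ℝ) : clockwiseRotation c α c = c := by
  simp [clockwiseRotation]

namespace LopspOperation

variable (O : LopspOperation.{u})

theorem decoration_connected : O.decoration.Connected := by
  rintro ⟨d⟩ ⟨d'⟩
  exact PlaneGraph.Reachable.induction
    (r := fun d d' => O.decoration.Reachable (O.proj d) (O.proj d')) (fun _ => .refl _)
    (fun _ _ h => h.symm) (fun _ _ _ h h' => h.trans h') (fun d => .σ (O.proj d))
    (fun d => .θ (O.proj d)) (O.T.connected.chamberSystem d d')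

theorem decoration_triangle (e : O.decoration.Dart) :
    O.decoration.σ (O.decoration.θ (O.decoration.σ (O.decoration.θ
      (O.decoration.σ (O.decoration.θ e))))) = e := by
  obtain ⟨d⟩ := e
  exact congrArg O.proj (O.T.graph.chamberSystem_triangle d)

theorem proj_mapPerm {φ : O.T.graph.Iso O.T.graph}
    (h : PlaneGraph.ChamberDart.mapPerm φ.toEquiv ∈ O.group) (d : O.T.graph.chamberSystem.Dart) :
    O.proj (PlaneGraph.ChamberDart.map φ.toEquiv d) = O.proj d :=
  Quotient.sound ⟨⟨_, h⟩, rfl⟩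

/-- Closed forms on the decoration are exact. The primitive of the lifted form on the plane is
invariant under both rotations, as these have fixed points, and hence descends. -/
theorem decoration_closedFormsExact : O.decoration.ClosedFormsExact := by
  intro ψ hψ hcl
  set C := O.T.graph.chamberSystem
  set ψ' : C.Dart → ℤ := fun d => ψ (O.proj d)
  set p := O.T.graph.cornerValue ψ' with hp
  obtain ⟨U, hU, hUp⟩ := Tiling.exists_lift_interpolation (T := O.T) (p := p)
    fun c i j k hj hk => O.T.graph.cornerValue_adjChamber (fun d => hψ (O.proj d))
      (fun d => hcl (O.proj d)) c hj hk
  have hinv : ∀ φ : O.T.graph.Iso O.T.graph, PlaneGraph.ChamberDart.mapPerm φ.toEquiv ∈ O.group →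
      ∀ e b j, p (φ.toEquiv e, b) j = p (e, b) j := by
    intro φ hφ e b j
    have hσ : O.T.graph.σ (φ.toEquiv e) = φ.toEquiv (O.T.graph.σ e) := (φ.map_σ e).symm
    fin_cases j
    · rfl
    · exact congrArg ψ (O.proj_mapPerm hφ (.ve e))
    · cases b
      · change ψ (O.proj (.vf (O.T.graph.σ (φ.toEquiv e)))) = _
        rw [hσ]
        exact congrArg ψ (O.proj_mapPerm hφ (.vf (O.T.graph.σ e)))
      · exact congrArg ψ (O.proj_mapPerm hφ (.vf e))
  have hsrc : ∀ {ρ : ℂ → ℂ} {φ : O.T.graph.Iso O.T.graph} (_ : O.T.Induces ρ φ) (d : C.Dart),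
      O.T.srcPoint (PlaneGraph.ChamberDart.map φ.toEquiv d) = ρ (O.T.srcPoint d) := by
    intro ρ φ h d
    refine Eq.trans ?_ (h _ _ _)
    cases d <;> rfl
  have hgroup : ∀ g ∈ O.group, ∀ d, U (O.T.srcPoint (g d)) = U (O.T.srcPoint d) := by
    intro g hg
    induction hg using Subgroup.closure_induction with
    | mem x hx =>
      intro d
      rcases hx with rfl | rfl
      · exact (congrArg U (hsrc O.induces₀ d)).trans <| Tiling.lift_interpolation_invariant hU hUp
          (continuous_clockwiseRotation _ _) O.induces₀
          (hinv O.ρ₀ (Subgroup.subset_closure (Or.inl rfl))) (clockwiseRotation_center _ _) _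
      · exact (congrArg U (hsrc O.induces₂ d)).trans <| Tiling.lift_interpolation_invariant hU hUp
          (continuous_clockwiseRotation _ _) O.induces₂
          (hinv O.ρ₂ (Subgroup.subset_closure (Or.inr rfl))) (clockwiseRotation_center _ _) _
    | one => exact fun d => rfl
    | mul x y _ _ hx hy => exact fun d => (hx (y d)).trans (hy d)
    | inv x _ hx =>
      intro d
      rw [← hx (x⁻¹ d), show x (x⁻¹ d) = d from Equiv.apply_symm_apply x d]
  refine ⟨Quotient.lift (fun d => U (O.T.srcPoint d)) ?_, ?_, ?_⟩
  · rintro a b ⟨g, rfl⟩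
    exact hgroup g.1 g.2 b
  · rintro ⟨d⟩
    exact congrArg U (O.T.srcPoint_σ d)
  · rintro ⟨d⟩
    change ((ψ' d : ℤ) : ℝ) = U (O.T.srcPoint (C.θ d)) - U (O.T.srcPoint d)
    have h1 : ∀ e, ψ' (.ev e) = -ψ' (.ve e) := fun e => hψ (O.proj (.ve e))
    have h2 : ∀ e, ψ' (.fv e) = -ψ' (.vf e) := fun e => hψ (O.proj (.vf e))
    have h3 : ∀ e, ψ' (.fe e) = -ψ' (.ef e) := fun e => hψ (O.proj (.ef e))
    have h4 : ∀ e, ψ' (.ve e) + ψ' (.ef e) + ψ' (.fv e) = 0 := fun e => hcl (O.proj (.ve e))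
    have h5 : ∀ e, ψ' (.ef e) = ψ' (.vf e) - ψ' (.ve e) := fun e => by linarith [h2 e, h4 e]
    have key := fun e => Tiling.lift_interpolation_sub hU hUp (e, true)
    cases d with
    | ve e => exact (key e 0 1).symm ▸ by simp [hp, PlaneGraph.cornerValue]
    | ev e => exact (key e 1 0).symm ▸ by simp [hp, PlaneGraph.cornerValue, h1]
    | vf e => exact (key e 0 2).symm ▸ by simp [hp, PlaneGraph.cornerValue]
    | fv e => exact (key e 2 0).symm ▸ by simp [hp, PlaneGraph.cornerValue, h2]
    | ef e => exact (key e 1 2).symm ▸ by simp [hp, PlaneGraph.cornerValue, h5]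
    | fe e => exact (key e 2 1).symm ▸ by simp [hp, PlaneGraph.cornerValue, h3, h5]

/-- The permutation `g` of the darts of the chamber system is induced by the map `ρ` of the plane. -/
def Realizes (g : Equiv.Perm O.T.graph.chamberSystem.Dart) (ρ : ℂ → ℂ) : Prop :=
  ∀ d x, O.T.point (PlaneGraph.ChamberDart.base (g d), true) x
    = ρ (O.T.point (PlaneGraph.ChamberDart.base d, true) x)

variable {O}

theorem Realizes.mul {g g' : Equiv.Perm O.T.graph.chamberSystem.Dart} {ρ ρ' : ℂ → ℂ}
    (h : O.Realizes g ρ) (h' : O.Realizes g' ρ') : O.Realizes (g * g') (fun z => ρ (ρ' z)) :=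
  fun d x => (h (g' d) x).trans (congrArg ρ (h' d x))

theorem Realizes.inv {g : Equiv.Perm O.T.graph.chamberSystem.Dart} {ρ ρ' : ℂ → ℂ}
    (h : O.Realizes g ρ) (hρ : ∀ z, ρ' (ρ z) = z) : O.Realizes g⁻¹ ρ' := by
  intro d x
  have h1 := h (g⁻¹ d) x
  rw [show g (g⁻¹ d) = d from Equiv.apply_symm_apply g d] at h1
  rw [h1, hρ]

theorem realizes_mapPerm {ρ : ℂ → ℂ} {φ : O.T.graph.Iso O.T.graph} (h : O.T.Induces ρ φ) :
    O.Realizes (PlaneGraph.ChamberDart.mapPerm φ.toEquiv) ρ := by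
  intro d x
  rw [← h]
  cases d <;> rfl

variable (O)

/-- The translations induced by elements of the group. -/
def translations : AddSubgroup ℂ where
  carrier := {t | ∃ g ∈ O.group, O.Realizes g (fun z => z + t)}
  zero_mem' := ⟨1, one_mem _, fun d x => (add_zero _).symm⟩
  add_mem' := by
    rintro s t ⟨g, hg, h⟩ ⟨g', hg', h'⟩
    refine ⟨g * g', mul_mem hg hg', fun d x => ?_⟩
    rw [h.mul h' d x]
    ring
  neg_mem' := by
    rintro t ⟨g, hg, h⟩
    exact ⟨g⁻¹, inv_mem hg, h.inv fun z => by ring⟩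

/-- The primitive sixth root of unity `exp(-iπ/3)`, the linear part of the rotation around `v₂`. -/
noncomputable def rotationFactor : ℂ := Complex.exp (-((Real.pi / 3 : ℝ) * Complex.I))

theorem rotationFactor_im : rotationFactor.im = -(√3 / 2) := by
  have : -(((Real.pi / 3 : ℝ) : ℂ) * Complex.I) = ((-(Real.pi / 3) : ℝ) : ℂ) * Complex.I := by
    push_cast
    ring
  rw [rotationFactor, this, Complex.exp_ofReal_mul_I_im, Real.sin_neg, Real.sin_pi_div_three]

theorem rotationFactor_pow_three : rotationFactor ^ 3 = -1 := by
  rw [rotationFactor, ← Complex.exp_nat_mul]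
  have : ((3 : ℕ) : ℂ) * -(((Real.pi / 3 : ℝ) : ℂ) * Complex.I) = -(Real.pi * Complex.I) := by
    push_cast
    ring
  rw [this, Complex.exp_neg, Complex.exp_pi_mul_I]
  norm_num

theorem rotationFactor_sq_ne_one : rotationFactor ^ 2 ≠ 1 := by
  intro h
  have h1 : rotationFactor = -1 := by
    rw [← rotationFactor_pow_three, pow_succ, h, one_mul]
  have h2 := rotationFactor_im
  rw [h1] at h2
  simp at h2

theorem clockwiseRotation_v₂ (z : ℂ) :
    clockwiseRotation O.v₂ (Real.pi / 3) z = O.v₂ + rotationFactor * (z - O.v₂) := rfl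

theorem clockwiseRotation_v₀ (z : ℂ) :
    clockwiseRotation O.v₀ (2 * Real.pi / 3) z = O.v₀ + rotationFactor ^ 2 * (z - O.v₀) := by
  rw [clockwiseRotation, rotationFactor, ← Complex.exp_nat_mul]
  congr 3
  push_cast
  ring

theorem mem_group_ρ₀ : PlaneGraph.ChamberDart.mapPerm O.ρ₀.toEquiv ∈ O.group :=
  Subgroup.subset_closure (Or.inl rfl)

theorem mem_group_ρ₂ : PlaneGraph.ChamberDart.mapPerm O.ρ₂.toEquiv ∈ O.group :=
  Subgroup.subset_closure (Or.inr rfl)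

/-- The rotations by `120` degrees around the two centres differ by a translation. -/
theorem translation_mem : (1 - rotationFactor ^ 2) * (O.v₀ - O.v₂) ∈ O.translations := by
  have h3 := rotationFactor_pow_three
  have h₂ := realizes_mapPerm O.induces₂
  have h₂' := (h₂.mul h₂).inv (ρ' := fun z => O.v₂ - rotationFactor * (z - O.v₂)) fun z => by
    simp only [clockwiseRotation_v₂]
    linear_combination (-(z - O.v₂)) * h3
  have key : ∀ z, clockwiseRotation O.v₀ (2 * Real.pi / 3) (O.v₂ - rotationFactor * (z - O.v₂))
      = z + (1 - rotationFactor ^ 2) * (O.v₀ - O.v₂) := fun z => by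
    rw [clockwiseRotation_v₀]
    linear_combination (-(z - O.v₂)) * h3
  exact ⟨_, mul_mem O.mem_group_ρ₀ (inv_mem (mul_mem O.mem_group_ρ₂ O.mem_group_ρ₂)),
    fun d x => ((realizes_mapPerm O.induces₀).mul h₂' d x).trans (key _)⟩

theorem rotationFactor_mul_mem {t : ℂ} (ht : t ∈ O.translations) :
    rotationFactor * t ∈ O.translations := by
  obtain ⟨g, hg, h⟩ := ht
  have h3 := rotationFactor_pow_three
  have h₂ := realizes_mapPerm O.induces₂
  have h₂' := h₂.inv (ρ' := fun z => O.v₂ - rotationFactor ^ 2 * (z - O.v₂)) fun z => by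
    rw [clockwiseRotation_v₂]
    linear_combination (-(z - O.v₂)) * h3
  have key : ∀ z, clockwiseRotation O.v₂ (Real.pi / 3)
      (O.v₂ - rotationFactor ^ 2 * (z - O.v₂) + t) = z + rotationFactor * t := fun z => by
    rw [clockwiseRotation_v₂]
    linear_combination (-(z - O.v₂)) * h3
  exact ⟨_, mul_mem (mul_mem O.mem_group_ρ₂ hg) (inv_mem O.mem_group_ρ₂),
    fun d x => ((h₂.mul h).mul h₂' d x).trans (key _)⟩

/-- The translations form a lattice, so they move every point into a fixed disc. -/
theorem exists_translation_norm_le (hne : O.v₀ ≠ O.v₂) :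
    ∃ r : ℝ, ∀ z : ℂ, ∃ t ∈ O.translations, ‖z + t‖ ≤ r := by
  set τ := (1 - rotationFactor ^ 2) * (O.v₀ - O.v₂) with hτ
  have hτ0 : τ ≠ 0 :=
    mul_ne_zero (sub_ne_zero.2 rotationFactor_sq_ne_one.symm) (sub_ne_zero.2 hne)
  have hτm : τ ∈ O.translations := O.translation_mem
  have him : rotationFactor.im ≠ 0 := by
    rw [rotationFactor_im]
    simp
  refine ⟨(1 + |rotationFactor.im|) * ‖τ‖, fun z => ?_⟩
  set w := z / τ
  -- Subtract multiples of `τ` times `rotationFactor` and of `τ`, the former to bound the imaginary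
  -- part of `z / τ`.
  set n : ℤ := ⌊w.im / rotationFactor.im⌋
  set m : ℤ := ⌊(w - n * rotationFactor).re⌋
  refine ⟨-(m • τ) - n • (rotationFactor * τ),
    sub_mem (neg_mem (zsmul_mem hτm m)) (zsmul_mem (O.rotationFactor_mul_mem hτm) n), ?_⟩
  have h1 : z + (-(m • τ) - n • (rotationFactor * τ)) = (w - n * rotationFactor - m) * τ := by
    have : z = w * τ := (div_mul_cancel₀ z hτ0).symm
    rw [this, zsmul_eq_mul, zsmul_eq_mul]
    ring
  rw [h1, norm_mul]
  refine mul_le_mul_of_nonneg_right ?_ (norm_nonneg _)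
  refine (Complex.norm_le_abs_re_add_abs_im _).trans (add_le_add ?_ ?_)
  · rw [Complex.sub_re, Complex.intCast_re]
    change |Int.fract (w - n * rotationFactor).re| ≤ 1
    rw [Int.abs_fract]
    exact (Int.fract_lt_one _).le
  · have h2 : (w - n * rotationFactor - m).im
        = Int.fract (w.im / rotationFactor.im) * rotationFactor.im := by
      simp only [Complex.sub_im, Complex.mul_im, Complex.intCast_re, Complex.intCast_im, Int.fract]
      field_simp
      ring
    rw [h2, abs_mul, Int.abs_fract]
    exact mul_le_of_le_one_left (abs_nonneg _) (Int.fract_lt_one _).le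

theorem decoration_finite (hne : O.v₀ ≠ O.v₂) : Finite O.decoration.Dart := by
  obtain ⟨r, hr⟩ := O.exists_translation_norm_le hne
  have h1 := O.T.locallyFinite.finite_nonempty_inter_compact (isCompact_closedBall (0 : ℂ) r)
  have h2 := PlaneGraph.ChamberDart.finite_base_mem (h1.image Prod.fst)
  refine Set.finite_univ_iff.1 ((h2.image O.proj).subset ?_)
  rintro ⟨d⟩ -
  obtain ⟨t, ⟨g, hg, h⟩, ht⟩ :=
    hr (O.T.point (PlaneGraph.ChamberDart.base d, true) (stdSimplex.vertex 0))
  refine ⟨g d, ⟨(PlaneGraph.ChamberDart.base (g d), true), ⟨_, ⟨stdSimplex.vertex 0, rfl⟩, ?_⟩, rfl⟩,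
    Quotient.sound ⟨⟨g, hg⟩, rfl⟩⟩
  rw [h d, mem_closedBall_zero_iff]
  exact ht

/-- There is only one vertex of the decoration at each point of the plane. -/
theorem IsVertexAt.unique {O : LopspOperation.{u}} {z : ℂ} {w w' : O.decoration.Vertex}
    (h : O.IsVertexAt z w) (h' : O.IsVertexAt z w') : w = w' := by
  obtain ⟨d, hd, rfl⟩ := h
  obtain ⟨d', hd', rfl⟩ := h'
  exact Tiling.apply_eq_of_srcPoint_eq (T := O.T) (F := fun d => O.decoration.src (O.proj d))
    (fun d => PlaneGraph.src_σ (O.proj d)) (hd.trans hd'.symm)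

end LopspOperation

theorem mainTheorem1
    (O : LopspOperation.{u})
    (v₀ v₁ v₂ : O.decoration.Vertex)
    (h₀ : O.IsVertexAt O.v₀ v₀) (h₁ : O.IsVertexAt O.v₁ v₁) (h₂ : O.IsVertexAt O.v₂ v₂)
    (G : PlaneGraph.{v})
    (P Q : PlaneGraph.CutPath O.decoration v₀ v₁ v₂) :
    ∃ f : PlaneGraph.Iso (PlaneGraph.application P G) (PlaneGraph.application Q G),
      ∀ x : O.decoration.Dart × G.DoubleChamber, O.label (f.toFun x).1 = O.label x.1 := by
  have hgauge : PlaneGraph.GaugeEquiv (P.s G) (Q.s G) := by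
    by_cases hne : O.v₀ = O.v₂
    · -- The two centres coincide: then so do the three vertices, and all paths are empty.
      have h₁₀ : v₁ = v₀ := by
        refine h₁.unique ?_
        rwa [show O.v₁ = O.v₀ by
          rw [LopspOperation.v₁, ← hne, clockwiseRotation_center, add_self_div_two]]
      have h₀₂ : v₀ = v₂ := h₀.unique (hne ▸ h₂)
      have hl₁ := (P.l₁_eq_nil_iff.2 h₁₀).trans (Q.l₁_eq_nil_iff.2 h₁₀).symm
      have hl₂ := (P.l₂_eq_nil_iff.2 h₀₂).trans (Q.l₂_eq_nil_iff.2 h₀₂).symm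
      have hPQ : P = Q := by
        cases P
        cases Q
        congr
      rw [hPQ]
      exact ⟨fun _ => 1, fun _ => rfl, fun _ => by simp⟩
    · have := O.decoration_finite hne
      exact P.s_gaugeEquiv O.decoration_connected O.decoration_triangle
        O.decoration_closedFormsExact Q G
  obtain ⟨f, hf⟩ := PlaneGraph.exists_iso_of_gaugeEquiv hgauge
  exact ⟨f, fun x => by rw [hf]⟩
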